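/- **Theorem 3 (Large Sample Inference I).** *Setting.* Let $(\mathcal S,\mathcal F,P)$ be a probability space, $P^*$ and $P_*$ the outer and inner probability, and let $o_p$ be understood with respect to $P^*$. For each $n$ let $L_n(\theta)$, $\theta\in\Theta\subset\mathbb R^d$, be a real-valued random criterion function, measurable in $\theta$ for every sample point and a random variable for every $\theta$. Let $\pi:\Theta\to\mathbb R_+$ be a weighting function, and define the quasi-posterior density, the quasi-posterior distribution function of $g(\theta)$ and its quantiles by $$p_n(\theta)=\frac{e^{L_n(\theta)}\pi(\theta)}{\int_\Theta e^{L_n(\theta')}\pi(\theta')\,d\theta'},\qquad F_{g,n}(x)=\int_{\theta\in\Theta:\,g(\theta)\le x}p_n(\theta)\,d\theta,\qquad c_{g,n}(\alpha)=\inf\{x:F_{g,n}(x)\ge\alpha\}.$$ *Assumptions.* 1. $\Theta$ is compact and convex, and $\theta_0$ belongs to the interior of $\Theta$. 2. $\pi$ is a continuous probability density on $\Theta$ that is bounded away from $0$. 3. For every $\delta>0$ there is $\epsilon>0$ with $$\liminf_{n\to\infty}P_*\Big\{\sup_{\theta\in\Theta,\,|\theta-\theta_0|\ge\delta}\tfrac1n\big(L_n(\theta)-L_n(\theta_0)\big)\le-\epsilon\Big\}=1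 .$$ 4. There are random vectors $\Delta_n$ in $\mathbb R^d$ and non-random symmetric matrices $J_n,\Omega_n$ such that, with $R_n(\theta)$ defined by $$L_n(\theta)-L_n(\theta_0)=(\theta-\theta_0)'\Delta_n-\tfrac12(\theta-\theta_0)'[nJ_n](\theta-\theta_0)+R_n(\theta),$$ (ii) $\Omega_n^{-1/2}\Delta_n/\sqrt n\to_d\mathcal N(0,I)$; (iii) $J_n$ and $\Omega_n$ are bounded and positive definite, uniformly in $n$; (iv) for every $\epsilon>0$ there are $\delta>0$ and $M>0$ such that, with suprema over $\theta\in\Theta$, $$\limsup_{n\to\infty}P^*\Big\{\sup_{M/\sqrt n\le|\theta-\theta_0|\le\delta}\frac{|R_n(\theta)|}{n|\theta-\theta_0|^2}>\epsilon\Big\}<\epsilon,\qquad \limsup_{n\to\infty}P^*\Big\{\sup_{|\theta-\theta_0|\le M/\sqrt n}|R_n(\theta)|>\epsilon\Big\}=0 .$$ 5. (Generalized information equality.) $\lim_{n\to\infty}J_n\Omega_n^{-1}=I$. *Conclusion.* Let $g$ be a real function that is continuously differentiable on $\Theta$, let $\alpha\in(0,1)$, and let $q_\alpha$ be the $\alpha$-quantile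 of $\mathcal N(0,1)$. For every estimator $\hat\theta=\hat\theta_n$ with $\sqrt n(\hat\theta-\theta_0)=J_n^{-1}\Delta_n/\sqrt n+o_p(1)$, $$c_{g,n}(\alpha)-g(\hat\theta)-q_\alpha\frac{\sqrt{\nabla g(\theta_0)'J_n^{-1}\nabla g(\theta_0)}}{\sqrt n}=o_p\Big(\frac1{\sqrt n}\Big).$$ If moreover $\nabla g(\theta_0)\neq0$, then $$\lim_{n\to\infty}P^*\big\{c_{g,n}(\alpha/2)\le g(\theta_0)\le c_{g,n}(1-\alpha/2)\big\}=1-\alpha .$$ -/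

import Mathlib

open MeasureTheory ProbabilityTheory Filter Topology Matrix
open scoped ENNReal

namespace LTE

/-- The Euclidean space `ℝ^d`, with the Euclidean norm. -/
abbrev Vec (d : ℕ) : Type := EuclideanSpace ℝ (Fin d)

noncomputable section

/-- The matrix-vector product `A x`. -/
def act {d : ℕ} (A : Matrix (Fin d) (Fin d) ℝ) (x : Vec d) : Vec d :=
  Matrix.toEuclideanCLM (𝕜 := ℝ) A x

/-- The quadratic form `x' A x`. -/
def quadForm {d : ℕ} (A : Matrix (Fin d) (Fin d) ℝ) (x : Vec d) : ℝ :=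
  inner ℝ x (act A x)

section InverseRoot

open scoped MatrixOrder

/-- `A^{-1/2}` for a positive definite matrix `A`: the positive semidefinite square root of
`A⁻¹`. -/
def invRoot {d : ℕ} (A : Matrix (Fin d) (Fin d) ℝ) : Matrix (Fin d) (Fin d) ℝ :=
  CFC.sqrt A⁻¹

end InverseRoot

/-- Inner probability `P_*(A) = 1 - P^*(Aᶜ)`. A Mathlib measure, applied to a set that need not be
measurable, is the outer measure, so `P A` itself is the outer probability `P^*(A)`. -/
def innerProb {S : Type*} [MeasurableSpace S] (P : Measure S) (A : Set S) : ℝ≥0∞ :=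
  1 - P Aᶜ

/-- `X_n = o_p(r_n)`: the sequence `X_n / r_n` converges to `0` in (outer) probability. -/
def IsLittleOP {S : Type*} [MeasurableSpace S] (P : Measure S) {E : Type*}
    [NormedAddCommGroup E] [NormedSpace ℝ E] (X : ℕ → S → E) (r : ℕ → ℝ) : Prop :=
  TendstoInMeasure P (fun n s => (r n)⁻¹ • X n s) atTop (fun _ => 0)

/-- The `α`-quantile `inf {x : F x ≥ α}` of a distribution function `F`. -/
def quantile (F : ℝ → ℝ) (α : ℝ) : ℝ :=
  sInf {x : ℝ | α ≤ F x}

/-- The `α`-quantile `q_α` of the standard normal distribution. -/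
def normalQuantile (α : ℝ) : ℝ :=
  quantile (fun x => cdf (gaussianReal 0 1) x) α

/-- The sequence of matrices is bounded, `A_n = O(1)`, symmetric, and positive definite uniformly
in `n`. -/
structure BoundedUniformlyPosDef {d : ℕ} (A : ℕ → Matrix (Fin d) (Fin d) ℝ) : Prop where
  symm : ∀ n, (A n).IsSymm
  bounded : ∃ C : ℝ, ∀ n i j, |A n i j| ≤ C
  posDef : ∃ c : ℝ, 0 < c ∧ ∀ n x, c * ‖x‖ ^ 2 ≤ quadForm (A n) x

/-- The true parameter is an interior point of a compact convex parameter space. -/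
structure ParameterAssumption {d : ℕ} (Θ : Set (Vec d)) (θ₀ : Vec d) : Prop where
  isCompact : IsCompact Θ
  convex : Convex ℝ Θ
  mem_interior : θ₀ ∈ interior Θ

/-- The weighting function is a continuous, uniformly positive probability density on `Θ`. -/
structure PriorAssumption {d : ℕ} (Θ : Set (Vec d)) (π : Vec d → ℝ) : Prop where
  continuousOn : ContinuousOn π Θ
  uniformly_pos : ∃ c : ℝ, 0 < c ∧ ∀ θ ∈ Θ, c ≤ π θ
  integral_eq_one : ∫ θ in Θ, π θ = 1

/-- The standing measurability of the criterion functions `L_n(θ)`, as functions of `θ ∈ Θ` and as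
functions on the sample space, and of the random vectors `Δ_n`. -/
structure MeasurabilityAssumption {d : ℕ} {S : Type*} [MeasurableSpace S] (Θ : Set (Vec d))
    (L : ℕ → Vec d → S → ℝ) (Δ : ℕ → S → Vec d) : Prop where
  parameter : ∀ n s, Measurable fun θ : Θ => L n (θ : Vec d) s
  sample : ∀ n, ∀ θ ∈ Θ, Measurable (L n θ)
  score : ∀ n, Measurable (Δ n)

/-- Identifiability. The event says that the supremum of `(L_n(θ) - L_n(θ₀)) / n` over the
`θ ∈ Θ` with `|θ - θ₀| ≥ δ` is at most `-ε`. -/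
def IdentifiabilityAssumption {d : ℕ} {S : Type*} [MeasurableSpace S] (P : Measure S)
    (Θ : Set (Vec d)) (θ₀ : Vec d) (L : ℕ → Vec d → S → ℝ) : Prop :=
  ∀ δ : ℝ, 0 < δ → ∃ ε : ℝ, 0 < ε ∧
    liminf (fun n : ℕ => innerProb P {s | ∀ θ ∈ Θ, δ ≤ ‖θ - θ₀‖ →
      (1 / (n : ℝ)) * (L n θ s - L n θ₀ s) ≤ -ε}) atTop = 1

/-- The remainder `R_n(θ)` of the quadratic expansion
`L_n(θ) - L_n(θ₀) = (θ - θ₀)' Δ_n - (θ - θ₀)' [n J_n] (θ - θ₀) / 2 + R_n(θ)`. -/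
def remainder {d : ℕ} {S : Type*} (θ₀ : Vec d) (L : ℕ → Vec d → S → ℝ) (Δ : ℕ → S → Vec d)
    (J : ℕ → Matrix (Fin d) (Fin d) ℝ) (n : ℕ) (s : S) (θ : Vec d) : ℝ :=
  L n θ s - L n θ₀ s - inner ℝ (θ - θ₀) (Δ n s)
    + (1 / 2) * quadForm ((n : ℝ) • J n) (θ - θ₀)

/-- The stochastic quadratic expansion of the criterion function around `θ₀`. In the last field,
"the supremum over a set exceeds `ε`" is written as "some point of the set exceeds `ε`". -/
structure ExpansionAssumption {d : ℕ} {S : Type*} [MeasurableSpace S] (P : Measure S)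
    [IsProbabilityMeasure P] (Θ : Set (Vec d)) (θ₀ : Vec d) (L : ℕ → Vec d → S → ℝ)
    (Δ : ℕ → S → Vec d) (J Ω : ℕ → Matrix (Fin d) (Fin d) ℝ) : Prop where
  score_tendsto : TendstoInDistribution
    (fun (n : ℕ) (s : S) => act (invRoot (Ω n)) ((√(n : ℝ))⁻¹ • Δ n s)) atTop
    (id : Vec d → Vec d) (fun _ => P) (stdGaussian (Vec d))
  hessian : BoundedUniformlyPosDef J
  variance : BoundedUniformlyPosDef Ω
  remainder_small : ∀ ε : ℝ, 0 < ε → ∃ δ : ℝ, 0 < δ ∧ ∃ M : ℝ, 0 < M ∧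
    limsup (fun n : ℕ => P {s | ∃ θ ∈ Θ, M / √(n : ℝ) ≤ ‖θ - θ₀‖ ∧ ‖θ - θ₀‖ ≤ δ ∧
      ε < |remainder θ₀ L Δ J n s θ| / ((n : ℝ) * ‖θ - θ₀‖ ^ 2)}) atTop < ENNReal.ofReal ε ∧
    limsup (fun n : ℕ => P {s | ∃ θ ∈ Θ, ‖θ - θ₀‖ ≤ M / √(n : ℝ) ∧
      ε < |remainder θ₀ L Δ J n s θ|}) atTop = 0

/-- The quasi-posterior density `p_n(θ) = e^{L_n(θ)} π(θ) / ∫_Θ e^{L_n} π` on `Θ`. -/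
def quasiPosterior {d : ℕ} {S : Type*} (Θ : Set (Vec d)) (π : Vec d → ℝ)
    (L : ℕ → Vec d → S → ℝ) (n : ℕ) (s : S) (θ : Vec d) : ℝ :=
  Real.exp (L n θ s) * π θ / ∫ θ' in Θ, Real.exp (L n θ' s) * π θ'

/-- The quasi-posterior distribution function `F_{g,n}(x) = ∫_{θ ∈ Θ : g(θ) ≤ x} p_n(θ) dθ`. -/
def quasiCDF {d : ℕ} {S : Type*} (Θ : Set (Vec d)) (π : Vec d → ℝ)
    (L : ℕ → Vec d → S → ℝ) (g : Vec d → ℝ) (n : ℕ) (s : S) (x : ℝ) : ℝ :=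
  ∫ θ in {θ | θ ∈ Θ ∧ g θ ≤ x}, quasiPosterior Θ π L n s θ

/-- The quasi-posterior quantile `c_{g,n}(α) = inf {x : F_{g,n}(x) ≥ α}`. -/
def quasiQuantile {d : ℕ} {S : Type*} (Θ : Set (Vec d)) (π : Vec d → ℝ)
    (L : ℕ → Vec d → S → ℝ) (g : Vec d → ℝ) (n : ℕ) (s : S) (α : ℝ) : ℝ :=
  quantile (quasiCDF Θ π L g n s) α

end

end LTE

/-! The probabilistic claims reduce to a deterministic Bernstein–von Mises limit. The remainder
bound, the identification bound and tightness of `Δ n / √n` hold outside sets of small outer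
measure. If `P (A n)` did not tend to `0`, sample points `s k ∈ A (ns k)` could therefore be picked
at which these bounds hold, with remainder accuracy improving in `k`. This uses only monotonicity
and subadditivity of outer measure, so the events need not be measurable. By compactness `J → J₀`
and the scaled score tends to some `D₀` along a subsequence, which is the situation of
`LocallyQuadratic`; see `tendsto_measure_zero_of_locallyQuadratic`.

For such a sequence put `h = √n (θ - θ₀)`. The weights converge to `π θ₀ * exp (h'D₀ - h'J₀h / 2)`:
by dominated convergence inside a ball, while the outside is exponentially small
(`LocallyQuadratic.tendsto_setIntegral`). The set `g θ ≤ g θ₀ + x / √n` becomes the half-space `∇g'h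
≤ x`, so the rescaled quantile tends to that of the normal law with mean `∇g'J₀⁻¹D₀` and variance
`∇g'J₀⁻¹∇g`. The delta method gives `g θhat` the same centre, whence the first claim.

For coverage, the same reduction writes the rescaled quantile as `V + q σ` up to a vanishing error,
with `V = ∇g'J⁻¹Δ/√n`. The limit law of the score and the information equality make `V`
asymptotically normal with variance `σ²` along subsequences, and the coverage event is squeezed
between events that place `V` in slightly narrower and wider intervals. -/

namespace LTE

/-! ### Coercive symmetric matrices, their inverses and inverse square roots -/

section LinearAlgebra

variable {d : ℕ}

theorem act_mul (A B : Matrix (Fin d) (Fin d) ℝ) (x : Vec d) :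
    act (A * B) x = act A (act B x) := by
  simp [act, map_mul]

theorem act_one (x : Vec d) : act (1 : Matrix (Fin d) (Fin d) ℝ) x = x := by
  simp [act, map_one]

theorem act_add (A : Matrix (Fin d) (Fin d) ℝ) (x y : Vec d) :
    act A (x + y) = act A x + act A y := by
  simp [act]

theorem act_smul (A : Matrix (Fin d) (Fin d) ℝ) (c : ℝ) (x : Vec d) :
    act A (c • x) = c • act A x := by
  simp [act]

theorem act_zero (A : Matrix (Fin d) (Fin d) ℝ) : act A (0 : Vec d) = 0 := by
  simp [act]

theorem inner_act (A : Matrix (Fin d) (Fin d) ℝ) (x y : Vec d) :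
    inner ℝ x (act A y) = inner ℝ (act Aᵀ x) y := by
  have h : Matrix.toEuclideanCLM (𝕜 := ℝ) Aᵀ
      = ContinuousLinearMap.adjoint (Matrix.toEuclideanCLM (𝕜 := ℝ) A) := by
    rw [← ContinuousLinearMap.star_eq_adjoint, ← map_star, Matrix.star_eq_conjTranspose,
      Matrix.conjTranspose_eq_transpose_of_trivial]
  rw [act, act, h, ContinuousLinearMap.adjoint_inner_left]

theorem inner_act_of_isSymm {A : Matrix (Fin d) (Fin d) ℝ} (hA : A.IsSymm) (x y : Vec d) :
    inner ℝ x (act A y) = inner ℝ (act A x) y := by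
  rw [inner_act, hA.eq]

theorem continuous_toEuclideanCLM :
    Continuous fun A : Matrix (Fin d) (Fin d) ℝ => Matrix.toEuclideanCLM (𝕜 := ℝ) A :=
  ({ toFun := fun A => Matrix.toEuclideanCLM (𝕜 := ℝ) A
     map_add' := fun A B => map_add _ A B
     map_smul' := fun c A => map_smul _ c A } :
    Matrix (Fin d) (Fin d) ℝ →ₗ[ℝ] Vec d →L[ℝ] Vec d).continuous_of_finiteDimensional

theorem act_eq_toLp (A : Matrix (Fin d) (Fin d) ℝ) (x : Vec d) :
    act A x = WithLp.toLp 2 (A *ᵥ x.ofLp) := by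
  rw [act, ← Matrix.toEuclideanCLM_toLp]

theorem continuous_act :
    Continuous fun p : Matrix (Fin d) (Fin d) ℝ × Vec d => act p.1 p.2 := by
  simp only [act_eq_toLp]
  exact (PiLp.continuous_toLp 2 _).comp
    (continuous_fst.matrix_mulVec ((PiLp.continuous_ofLp 2 _).comp continuous_snd))

theorem tendsto_act {ι : Type*} {l : Filter ι} {A : ι → Matrix (Fin d) (Fin d) ℝ}
    {A₀ : Matrix (Fin d) (Fin d) ℝ} {x : ι → Vec d} {x₀ : Vec d} (hA : Tendsto A l (𝓝 A₀))
    (hx : Tendsto x l (𝓝 x₀)) : Tendsto (fun i => act (A i) (x i)) l (𝓝 (act A₀ x₀)) := by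
  have h1 : Tendsto (fun i => (A i, x i)) l (𝓝 (A₀, x₀)) := hA.prodMk_nhds hx
  have h2 := Tendsto.comp (g := fun p : Matrix (Fin d) (Fin d) ℝ × Vec d => act p.1 p.2)
    (continuous_act.tendsto (A₀, x₀)) h1
  exact h2

theorem tendsto_quadForm {ι : Type*} {l : Filter ι} {A : ι → Matrix (Fin d) (Fin d) ℝ}
    {A₀ : Matrix (Fin d) (Fin d) ℝ} {x : ι → Vec d} {x₀ : Vec d} (hA : Tendsto A l (𝓝 A₀))
    (hx : Tendsto x l (𝓝 x₀)) : Tendsto (fun i => quadForm (A i) (x i)) l (𝓝 (quadForm A₀ x₀)) :=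
  hx.inner (tendsto_act hA hx)

theorem continuous_quadForm (A : Matrix (Fin d) (Fin d) ℝ) : Continuous (quadForm A) :=
  continuous_id.inner (Matrix.toEuclideanCLM (𝕜 := ℝ) A).continuous

theorem quadForm_smul (A : Matrix (Fin d) (Fin d) ℝ) (c : ℝ) (x : Vec d) :
    quadForm A (c • x) = c ^ 2 * quadForm A x := by
  simp only [quadForm, act_smul, inner_smul_left, inner_smul_right, conj_trivial]; ring

theorem quadForm_smul_left (A : Matrix (Fin d) (Fin d) ℝ) (c : ℝ) (x : Vec d) :
    quadForm (c • A) x = c * quadForm A x := by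
  simp [quadForm, act, inner_smul_right]

theorem quadForm_add {A : Matrix (Fin d) (Fin d) ℝ} (hA : A.IsSymm) (x y : Vec d) :
    quadForm A (x + y) = quadForm A x + 2 * inner ℝ y (act A x) + quadForm A y := by
  simp only [quadForm, act_add, inner_add_left, inner_add_right]
  rw [inner_act_of_isSymm hA x y, real_inner_comm y (act A x)]; ring

/-- A symmetric matrix whose quadratic form is at least `c ‖x‖²` with `c > 0`. -/
structure IsCoercive (A : Matrix (Fin d) (Fin d) ℝ) (c : ℝ) : Prop where
  symm : A.IsSymm
  pos : 0 < c
  le : ∀ x, c * ‖x‖ ^ 2 ≤ quadForm A x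

variable {A : Matrix (Fin d) (Fin d) ℝ} {c : ℝ}

theorem IsCoercive.posDef (h : IsCoercive A c) : A.PosDef := by
  rw [Matrix.posDef_iff_dotProduct_mulVec]
  refine ⟨by rw [Matrix.IsHermitian, Matrix.conjTranspose_eq_transpose_of_trivial]; exact h.symm,
    fun x hx => ?_⟩
  have h1 := h.le (WithLp.toLp 2 x)
  have h2 : 0 < ‖(WithLp.toLp 2 x : Vec d)‖ := by
    rw [norm_pos_iff]; simpa using hx
  have h3 : quadForm A (WithLp.toLp 2 x) = star x ⬝ᵥ A *ᵥ x := by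
    rw [quadForm, act, Matrix.toEuclideanCLM_toLp, EuclideanSpace.inner_toLp_toLp, dotProduct_comm]
  rw [← h3]
  exact lt_of_lt_of_le (mul_pos h.pos (pow_pos h2 2)) h1

theorem IsCoercive.isUnit_det (h : IsCoercive A c) : IsUnit A.det :=
  (Matrix.isUnit_iff_isUnit_det _).1 h.posDef.isUnit

theorem IsCoercive.act_act_inv (h : IsCoercive A c) (x : Vec d) : act A (act A⁻¹ x) = x := by
  rw [← act_mul, Matrix.mul_nonsing_inv _ h.isUnit_det, act_one]

theorem IsCoercive.act_inv_act (h : IsCoercive A c) (x : Vec d) : act A⁻¹ (act A x) = x := by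
  rw [← act_mul, Matrix.nonsing_inv_mul _ h.isUnit_det, act_one]

theorem IsCoercive.inv_isSymm (h : IsCoercive A c) : (A⁻¹).IsSymm := by
  rw [Matrix.IsSymm, Matrix.transpose_nonsing_inv, h.symm.eq]

section Root
open scoped MatrixOrder

theorem IsCoercive.invRoot_mul_self (h : IsCoercive A c) : invRoot A * invRoot A = A⁻¹ :=
  CFC.sqrt_mul_sqrt_self _ (Matrix.nonneg_iff_posSemidef.2 h.posDef.inv.posSemidef)

theorem invRoot_isSymm (A : Matrix (Fin d) (Fin d) ℝ) : (invRoot A).IsSymm := by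
  have := (Matrix.nonneg_iff_posSemidef.1 (CFC.sqrt_nonneg A⁻¹)).isHermitian
  rwa [Matrix.IsHermitian, Matrix.conjTranspose_eq_transpose_of_trivial] at this

end Root

theorem IsCoercive.act_invRoot_act_invRoot (h : IsCoercive A c) (x : Vec d) :
    act (invRoot A) (act (invRoot A) x) = act A⁻¹ x := by
  rw [← act_mul, h.invRoot_mul_self]

theorem IsCoercive.norm_act_invRoot_sq (h : IsCoercive A c) (x : Vec d) :
    ‖act (invRoot A) x‖ ^ 2 = quadForm A⁻¹ x := by
  rw [← real_inner_self_eq_norm_sq, ← inner_act_of_isSymm (invRoot_isSymm A),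
    h.act_invRoot_act_invRoot, quadForm]

theorem IsCoercive.quadForm_act_invRoot (h : IsCoercive A c) (x : Vec d) :
    quadForm A (act (invRoot A) x) = ‖x‖ ^ 2 := by
  have h1 : act (invRoot A) (act A (act (invRoot A) x)) = x := by
    have h2 : invRoot A * (A * invRoot A) = 1 := by
      rw [← Matrix.mul_assoc]
      -- For square matrices a one-sided inverse is two-sided, so the product may be rotated
      -- cyclically until it reads `A⁻¹ * A`; commutation of the root with `A` is not needed.
      apply mul_eq_one_comm.1
      rw [← Matrix.mul_assoc, h.invRoot_mul_self, Matrix.nonsing_inv_mul _ h.isUnit_det]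
    rw [← act_mul, ← act_mul, Matrix.mul_assoc, h2, act_one]
  rw [quadForm, ← inner_act_of_isSymm (invRoot_isSymm A), h1, real_inner_self_eq_norm_sq]

/-- With `y = A⁻¹ x` one has `x'A⁻¹x = y'Ay ≥ c ‖y‖²`, and `‖x‖ = ‖A y‖ ≤ C ‖y‖`. -/
theorem IsCoercive.quadForm_inv_ge (h : IsCoercive A c) {C : ℝ} (hC : ∀ x, ‖act A x‖ ≤ C * ‖x‖)
    (hC0 : 0 < C) (x : Vec d) : c * (C⁻¹ * ‖x‖) ^ 2 ≤ quadForm A⁻¹ x := by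
  have h1 := h.le (act A⁻¹ x)
  rw [quadForm, h.act_act_inv, real_inner_comm] at h1
  have h2 := hC (act A⁻¹ x)
  rw [h.act_act_inv] at h2
  refine le_trans ?_ h1
  have h3 : C⁻¹ * ‖x‖ ≤ ‖act A⁻¹ x‖ := by
    rwa [inv_mul_le_iff₀ hC0]
  have := h.pos
  gcongr

theorem IsCoercive.quadForm_inv_pos (h : IsCoercive A c) {x : Vec d} (hx : x ≠ 0) :
    0 < quadForm A⁻¹ x := by
  have h1 := h.le (act A⁻¹ x)
  rw [quadForm, h.act_act_inv, real_inner_comm] at h1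
  refine lt_of_lt_of_le (mul_pos h.pos (pow_pos (norm_pos_iff.2 fun h0 => hx ?_) 2)) h1
  rw [← h.act_act_inv x, h0, act_zero]

theorem isCoercive_of_tendsto {ι : Type*} {l : Filter ι} [l.NeBot]
    {B : ι → Matrix (Fin d) (Fin d) ℝ} (hB : ∀ i, IsCoercive (B i) c) (h : Tendsto B l (𝓝 A)) :
    IsCoercive A c where
  symm := by
    have h1 : Tendsto (fun i => (B i)ᵀ) l (𝓝 Aᵀ) :=
      (Continuous.matrix_transpose continuous_id).continuousAt.tendsto.comp h
    have h2 : (fun i => (B i)ᵀ) = B := funext fun i => (hB i).symm.eq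
    rw [h2] at h1
    exact tendsto_nhds_unique h1 h
  pos := by
    obtain ⟨i⟩ := l.nonempty_of_neBot
    exact (hB i).pos
  le x := ge_of_tendsto (tendsto_quadForm h tendsto_const_nhds) (.of_forall fun i => (hB i).le x)

/-- Cramer's rule: the inverse is the adjugate divided by the determinant, both continuous. -/
theorem tendsto_matrix_inv {ι : Type*} {l : Filter ι} {B : ι → Matrix (Fin d) (Fin d) ℝ}
    (hA : IsUnit A.det) (h : Tendsto B l (𝓝 A)) : Tendsto (fun i => (B i)⁻¹) l (𝓝 A⁻¹) := by
  have h1 : Tendsto (fun i => (B i).det⁻¹) l (𝓝 A.det⁻¹) :=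
    ((Continuous.matrix_det (A := fun M : Matrix (Fin d) (Fin d) ℝ => M)
      continuous_id).continuousAt.tendsto.comp h).inv₀ hA.ne_zero
  have h2 : Tendsto (fun i => (B i).adjugate) l (𝓝 A.adjugate) :=
    (Continuous.matrix_adjugate (A := fun M : Matrix (Fin d) (Fin d) ℝ => M)
      continuous_id).continuousAt.tendsto.comp h
  simp only [Matrix.inv_def, Ring.inverse_eq_inv']
  exact h1.smul h2

theorem isCompact_abs_entries_le (C : ℝ) :
    IsCompact {M : Matrix (Fin d) (Fin d) ℝ | ∀ i j, |M i j| ≤ C} := by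
  have h := isCompact_univ_pi (fun _ : Fin d => isCompact_univ_pi (fun _ : Fin d =>
    isCompact_Icc (a := -C) (b := C)))
  have h2 : {M : Matrix (Fin d) (Fin d) ℝ | ∀ i j, |M i j| ≤ C} = (Set.univ.pi fun _ : Fin d =>
      Set.univ.pi fun _ : Fin d => Set.Icc (-C) C : Set (Fin d → Fin d → ℝ)) := by
    exact Set.ext fun M => ⟨fun h i _ j _ => abs_le.1 (h i j),
      fun h i j => abs_le.2 (h i trivial j trivial)⟩
  rw [h2]
  exact h

/-- Matrices with entries bounded by `C` form a compact set, whose continuous image among the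
operators is bounded. -/
theorem exists_norm_act_le {B : ℕ → Matrix (Fin d) (Fin d) ℝ}
    (hB : ∃ C : ℝ, ∀ n i j, |B n i j| ≤ C) : ∃ C : ℝ, 0 < C ∧ ∀ n x, ‖act (B n) x‖ ≤ C * ‖x‖ := by
  obtain ⟨C, hC⟩ := hB
  obtain ⟨R, hR⟩ :=
    ((isCompact_abs_entries_le C).image continuous_toEuclideanCLM).isBounded.exists_norm_le
  refine ⟨max R 1, by positivity, fun n x => ?_⟩
  refine (ContinuousLinearMap.le_opNorm _ _).trans ?_
  gcongr
  exact (hR _ ⟨B n, hC n, rfl⟩).trans (le_max_left _ _)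

/-- `J n` and `Ω n` are not assumed to converge; this compactness supplies limits along
subsequences. -/
theorem exists_subseq_tendsto_matrix {B : ℕ → Matrix (Fin d) (Fin d) ℝ}
    (hB : ∃ C : ℝ, ∀ n i j, |B n i j| ≤ C) (ns : ℕ → ℕ) : ∃ (B₀ : Matrix (Fin d) (Fin d) ℝ)
      (φ : ℕ → ℕ), StrictMono φ ∧ Tendsto (fun k => B (ns (φ k))) atTop (𝓝 B₀) := by
  obtain ⟨C, hC⟩ := hB
  have : FirstCountableTopology (Matrix (Fin d) (Fin d) ℝ) :=
    inferInstanceAs (FirstCountableTopology (Fin d → Fin d → ℝ))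
  obtain ⟨B₀, -, φ, hφ, h⟩ := (isCompact_abs_entries_le C).isSeqCompact (fun k => hC (ns k))
  exact ⟨B₀, φ, hφ, h⟩

end LinearAlgebra

/-! ### Gaussian integrals and laws of linear functionals -/

section Gaussian

variable {d : ℕ}

theorem integrable_exp_neg_mul_sq_norm {b : ℝ} (hb : 0 < b) :
    Integrable fun z : Vec d => Real.exp (-b * ‖z‖ ^ 2) := by
  -- The Bochner integral of a non-integrable function is `0` by convention, so a nonzero value
  -- proves integrability.
  refine Integrable.of_integral_ne_zero ?_
  rw [GaussianFourier.integral_rexp_neg_mul_sq_norm hb]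
  positivity

/-- Completing the square absorbs the linear term into half of the quadratic decay. Such functions
are the dominating functions below. -/
theorem integrable_exp_linear_sub_sq {b : ℝ} (hb : 0 < b) (a K : ℝ) :
    Integrable fun z : Vec d => Real.exp (a + K * ‖z‖ - b * ‖z‖ ^ 2) := by
  refine ((integrable_exp_neg_mul_sq_norm (d := d) (half_pos hb)).const_mul
    (Real.exp (a + K ^ 2 / (2 * b)))).mono' (by fun_prop) (.of_forall fun z => ?_)
  rw [Real.norm_of_nonneg (Real.exp_nonneg _), ← Real.exp_add, Real.exp_le_exp]
  have h : K * ‖z‖ ≤ K ^ 2 / (2 * b) + b / 2 * ‖z‖ ^ 2 := by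
    rw [← sub_nonneg]
    have : K ^ 2 / (2 * b) + b / 2 * ‖z‖ ^ 2 - K * ‖z‖ = (K - b * ‖z‖) ^ 2 / (2 * b) := by
      field_simp; ring
    rw [this]; positivity
  linarith

theorem inner_sub_half_quadForm_le {A : Matrix (Fin d) (Fin d) ℝ} {c : ℝ} (hA : IsCoercive A c)
    (D h : Vec d) : inner ℝ h D - 1 / 2 * quadForm A h ≤ ‖D‖ * ‖h‖ - c / 2 * ‖h‖ ^ 2 := by
  have h1 := hA.le h
  have h2 := real_inner_le_norm h D
  nlinarith

theorem integrable_exp_inner_sub_quadForm {A : Matrix (Fin d) (Fin d) ℝ} {c : ℝ}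
    (hA : IsCoercive A c) (D : Vec d) :
    Integrable fun h : Vec d => Real.exp (inner ℝ h D - 1 / 2 * quadForm A h) := by
  have hc := continuous_quadForm A
  refine (integrable_exp_linear_sub_sq (half_pos hA.pos) 0 ‖D‖).mono' (by fun_prop)
    (.of_forall fun h => ?_)
  rw [Real.norm_of_nonneg (Real.exp_nonneg _), Real.exp_le_exp, zero_add]
  exact inner_sub_half_quadForm_le hA D h

/-- The standard Gaussian measure has density proportional to `exp (-‖z‖² / 2)`. -/
theorem stdGaussian_eq_withDensity : stdGaussian (Vec d) = volume.withDensity fun z : Vec d =>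
    ENNReal.ofReal ((∫ y : Vec d, Real.exp (-(1 / 2) * ‖y‖ ^ 2))⁻¹
      * Real.exp (-(1 / 2) * ‖z‖ ^ 2)) := by
  set Z := ∫ y : Vec d, Real.exp (-(1 / 2) * ‖y‖ ^ 2) with hZ
  have hint := integrable_exp_neg_mul_sq_norm (d := d) (b := 1 / 2) (by norm_num)
  have hZpos : 0 < Z := integral_exp_pos hint
  have hpos : ∀ z : Vec d, 0 ≤ Z⁻¹ * Real.exp (-(1 / 2) * ‖z‖ ^ 2) := fun z => by positivity
  have hfin : IsFiniteMeasure (volume.withDensity fun z : Vec d =>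
      ENNReal.ofReal (Z⁻¹ * Real.exp (-(1 / 2) * ‖z‖ ^ 2))) :=
    isFiniteMeasure_withDensity_ofReal (hint.const_mul _).2
  have hb : 0 < (1 / 2 : ℂ).re := by norm_num
  refine Measure.ext_of_charFun (funext fun t => ?_)
  rw [charFun_stdGaussian, charFun_apply, integral_withDensity_eq_integral_toReal_smul
    (by fun_prop) (.of_forall fun _ => ENNReal.ofReal_lt_top)]
  have h1 := GaussianFourier.integral_cexp_neg_mul_sq_norm_add (V := Vec d) hb Complex.I t
  -- The same formula at frequency zero evaluates `Z`, so the normalization cancels against the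
  -- Fourier integral.
  have h0 := GaussianFourier.integral_cexp_neg_mul_sq_norm_add (V := Vec d) hb 0 (0 : Vec d)
  have hZC : (Z : ℂ) = ((Real.pi : ℂ) / (1 / 2)) ^ ((Module.finrank ℝ (Vec d) : ℂ) / 2) := by
    rw [hZ, ← integral_complex_ofReal]
    simpa using h0
  have h2 : ∀ z : Vec d, (ENNReal.ofReal (Z⁻¹ * Real.exp (-(1 / 2) * ‖z‖ ^ 2))).toReal
      • Complex.exp (((inner ℝ z t : ℝ) : ℂ) * Complex.I)
      = (Z : ℂ)⁻¹ * Complex.exp (-(1 / 2) * (‖z‖ : ℂ) ^ 2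
        + Complex.I * ((inner ℝ t z : ℝ) : ℂ)) := fun z => by
    rw [ENNReal.toReal_ofReal (hpos z), Complex.real_smul, Complex.exp_add, real_inner_comm]
    push_cast
    ring_nf
  simp_rw [h2]
  rw [integral_const_mul, h1, ← hZC, ← mul_assoc,
    inv_mul_cancel₀ (by exact_mod_cast hZpos.ne'), one_mul, Complex.I_sq]
  congr 1
  ring

theorem setIntegral_exp_neg_half_sq {A : Set (Vec d)} (hA : MeasurableSet A) :
    ∫ z in A, Real.exp (-(1 / 2) * ‖z‖ ^ 2)
      = (∫ y : Vec d, Real.exp (-(1 / 2) * ‖y‖ ^ 2)) * (stdGaussian (Vec d)).real A := by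
  have hint := integrable_exp_neg_mul_sq_norm (d := d) (b := 1 / 2) (by norm_num)
  have hZpos : 0 < ∫ y : Vec d, Real.exp (-(1 / 2) * ‖y‖ ^ 2) := integral_exp_pos hint
  rw [measureReal_def, stdGaussian_eq_withDensity, withDensity_apply _ hA,
    ← ofReal_integral_eq_lintegral_ofReal (hint.const_mul _).integrableOn
      (.of_forall fun z => by positivity),
    ENNReal.toReal_ofReal (integral_nonneg fun z => by positivity), integral_const_mul,
    mul_inv_cancel_left₀ hZpos.ne']

theorem stdGaussian_map_inner (u : Vec d) :
    (stdGaussian (Vec d)).map (fun z => inner ℝ u z)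
      = (gaussianReal 0 1).map (fun t => ‖u‖ * t) := by
  have h1 : IsProbabilityMeasure ((stdGaussian (Vec d)).map (fun z => inner ℝ u z)) :=
    Measure.isProbabilityMeasure_map (by fun_prop)
  have h2 : IsProbabilityMeasure ((gaussianReal 0 1).map (fun t => ‖u‖ * t)) :=
    Measure.isProbabilityMeasure_map (by fun_prop)
  refine Measure.ext_of_charFun (funext fun t => ?_)
  have h3 := charFun_map_smul (μ := gaussianReal 0 1) ‖u‖ t
  simp only [smul_eq_mul] at h3
  rw [h3, charFun_gaussianReal, charFun_apply, integral_map (by fun_prop) (by fun_prop)]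
  have h4 := charFun_stdGaussian (E := Vec d) (t • u)
  rw [charFun_apply] at h4
  simp only [inner_smul_right] at h4
  have h5 : ∀ z : Vec d, inner ℝ (inner ℝ u z : ℝ) t = t * inner ℝ z u := fun z => by
    rw [real_inner_comm u z]; simp
  simp_rw [h5]
  rw [h4, norm_smul, Real.norm_eq_abs]
  congr 1
  push_cast
  rw [mul_pow, ← Complex.ofReal_pow |t|, sq_abs]
  simp; ring

theorem stdGaussian_real_inner_mem (u : Vec d) {B : Set ℝ} (hB : MeasurableSet B) :
    (stdGaussian (Vec d)).real {z | inner ℝ u z ∈ B}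
      = (gaussianReal 0 1).real {t | ‖u‖ * t ∈ B} := by
  have h := congrArg (fun μ => μ.real B) (stdGaussian_map_inner u)
  simp only at h
  rwa [map_measureReal_apply (by fun_prop) hB, map_measureReal_apply (by fun_prop) hB] at h

theorem integral_comp_affine (T : Vec d →L[ℝ] Vec d) (hT : Function.Bijective T) (m : Vec d)
    (f : Vec d → ℝ) : ∫ h, f h = |T.det| * ∫ z, f (m + T z) := by
  have h1 := integral_image_eq_integral_abs_det_fderiv_smul (volume : Measure (Vec d))
    MeasurableSet.univ (f := fun z => m + T z) (f' := fun _ => T)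
    (fun z _ => (T.hasFDerivAt.const_add m).hasFDerivWithinAt)
    (fun x _ y _ hxy => hT.1 (add_left_cancel hxy)) f
  have h2 : (fun z => m + T z) '' Set.univ = Set.univ := by
    rw [Set.image_univ, Set.range_eq_univ]
    exact (add_left_surjective m).comp hT.2
  rw [h2] at h1
  simp only [Measure.restrict_univ, smul_eq_mul] at h1
  rw [h1, integral_const_mul]

/-- The distribution function of a linear functional under the density proportional to
`exp (h'D - h'Ah / 2)`, which is the Gaussian density with mean `A⁻¹D` and covariance `A⁻¹`. -/
theorem setIntegral_exp_div_integral {A : Matrix (Fin d) (Fin d) ℝ} {c : ℝ} (hA : IsCoercive A c)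
    (D v : Vec d) (x : ℝ) :
    (∫ h in {h | inner ℝ v h ≤ x}, Real.exp (inner ℝ h D - 1 / 2 * quadForm A h))
        / (∫ h, Real.exp (inner ℝ h D - 1 / 2 * quadForm A h))
      = (gaussianReal 0 1).real
        {t | √(quadForm A⁻¹ v) * t ≤ x - inner ℝ v (act A⁻¹ D)} := by
  -- Whitening `h = m + A^{-1/2} z` with `m = A⁻¹D` turns the exponent into `m'D / 2 - ‖z‖² / 2`.
  -- The constant and the Jacobian cancel in the quotient, and the half-space now has normal
  -- `A^{-1/2} v`, of length `√(v'A⁻¹v)`.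
  set T := Matrix.toEuclideanCLM (𝕜 := ℝ) (invRoot A) with hT
  have hTact : ∀ z, T z = act (invRoot A) z := fun z => rfl
  set m := act A⁻¹ D with hm
  have hAm : act A m = D := hA.act_act_inv D
  have hinj : Function.Injective T := by
    rw [injective_iff_map_eq_zero]
    intro z hz
    have := hA.quadForm_act_invRoot z
    rw [← hTact, hz, quadForm, act_zero, inner_zero_left] at this
    simpa using this.symm
  have hbij : Function.Bijective T :=
    ⟨hinj, (LinearMap.injective_iff_surjective (f := T.toLinearMap)).1 hinj⟩
  have hexp : ∀ z, inner ℝ (m + T z) D - 1 / 2 * quadForm A (m + T z)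
      = 1 / 2 * inner ℝ m D + -(1 / 2) * ‖z‖ ^ 2 := fun z => by
    rw [quadForm_add hA.symm, hAm, hTact, hA.quadForm_act_invRoot, inner_add_left, quadForm, hAm]
    ring
  have hset : ∀ z, m + T z ∈ {h | inner ℝ v h ≤ x} ↔
      z ∈ {z | inner ℝ (act (invRoot A) v) z ∈ Set.Iic (x - inner ℝ v m)} := fun z => by
    simp only [Set.mem_ofPred_eq, Set.mem_Iic]
    rw [inner_add_right, hTact, inner_act_of_isSymm (invRoot_isSymm A), le_sub_iff_add_le']
  have hmeas : MeasurableSet {h : Vec d | inner ℝ v h ≤ x} :=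
    measurableSet_le (by fun_prop) (by fun_prop)
  have hmeas' : MeasurableSet {z : Vec d | inner ℝ (act (invRoot A) v) z
      ∈ Set.Iic (x - inner ℝ v m)} :=
    (by fun_prop : Measurable fun z : Vec d => inner ℝ (act (invRoot A) v) z) measurableSet_Iic
  have hnum : (∫ h in {h | inner ℝ v h ≤ x}, Real.exp (inner ℝ h D - 1 / 2 * quadForm A h))
      = |T.det| * (Real.exp (1 / 2 * inner ℝ m D)
        * ∫ z in {z | inner ℝ (act (invRoot A) v) z ∈ Set.Iic (x - inner ℝ v m)},
          Real.exp (-(1 / 2) * ‖z‖ ^ 2)) := by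
    rw [← integral_indicator hmeas, integral_comp_affine T hbij m,
      ← integral_indicator hmeas']
    congr 1
    rw [← integral_const_mul]
    congr 1
    funext z
    by_cases hz : m + T z ∈ {h | inner ℝ v h ≤ x}
    · rw [Set.indicator_of_mem hz, Set.indicator_of_mem ((hset z).1 hz), hexp, Real.exp_add]
    · rw [Set.indicator_of_notMem hz, Set.indicator_of_notMem fun h => hz ((hset z).2 h),
        mul_zero]
  have hden : (∫ h, Real.exp (inner ℝ h D - 1 / 2 * quadForm A h))
      = |T.det| * (Real.exp (1 / 2 * inner ℝ m D) * ∫ z : Vec d,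
          Real.exp (-(1 / 2) * ‖z‖ ^ 2)) := by
    rw [integral_comp_affine T hbij m]
    simp_rw [hexp, Real.exp_add, integral_const_mul]
  have hpos : 0 < ∫ h, Real.exp (inner ℝ h D - 1 / 2 * quadForm A h) :=
    integral_exp_pos (integrable_exp_inner_sub_quadForm hA D)
  rw [setIntegral_exp_neg_half_sq hmeas', stdGaussian_real_inner_mem _ measurableSet_Iic] at hnum
  have hsq : ‖act (invRoot A) v‖ = √(quadForm A⁻¹ v) := by
    rw [← hA.norm_act_invRoot_sq, Real.sqrt_sq (norm_nonneg _)]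
  rw [hsq] at hnum
  rw [div_eq_iff hpos.ne', hnum, hden]
  simp only [Set.mem_Iic]
  ring

end Gaussian

/-! ### Quantiles and the standard normal distribution function -/

section Quantile

theorem quantile_mem_Icc {F : ℝ → ℝ} (hF : Monotone F) {α a b : ℝ} (ha : F a < α) (hb : α ≤ F b) :
    quantile F α ∈ Set.Icc a b := by
  have hbdd : a ∈ lowerBounds {x : ℝ | α ≤ F x} := fun x hx => by
    by_contra! h
    exact absurd (hF h.le) (not_le.2 (ha.trans_le hx))
  exact ⟨le_csInf ⟨b, hb⟩ hbdd, csInf_le ⟨a, hbdd⟩ hb⟩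

theorem cdf_lt_of_lt_quantile {μ : Measure ℝ} {α x : ℝ} (hα : 0 < α)
    (hx : x < quantile (fun x => cdf μ x) α) : cdf μ x < α := by
  by_contra! h
  have hbdd : BddBelow {x : ℝ | α ≤ cdf μ x} := by
    obtain ⟨a, ha⟩ := ((tendsto_cdf_atBot μ).eventually_lt_const hα).exists
    refine ⟨a, fun y hy => ?_⟩
    by_contra! h'
    exact absurd (monotone_cdf μ h'.le) (not_le.2 (ha.trans_le hy))
  exact absurd (csInf_le hbdd h) (not_le.2 hx)

/-- The left limit at `q` is at most `α` and the right limit at least `α`; they agree because the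
Gaussian law has no atoms. -/
theorem cdf_normalQuantile {α : ℝ} (hα : α ∈ Set.Ioo (0 : ℝ) 1) :
    cdf (gaussianReal 0 1) (normalQuantile α) = α := by
  set μ := gaussianReal 0 1
  set q := normalQuantile α with hq
  have hne : {x : ℝ | α ≤ cdf μ x}.Nonempty := by
    obtain ⟨b, hb⟩ := ((tendsto_cdf_atTop μ).eventually_const_lt hα.2).exists
    exact ⟨b, hb.le⟩
  apply le_antisymm
  · have hatom : μ {q} = 0 :=
      gaussianReal_absolutelyContinuous 0 one_ne_zero Real.volume_singleton
    rw [← measure_cdf μ, StieltjesFunction.measure_singleton, ENNReal.ofReal_eq_zero] at hatom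
    have hlim : Function.leftLim (cdf μ) q ≤ α := by
      refine le_of_tendsto ((monotone_cdf μ).tendsto_leftLim q) ?_
      filter_upwards [self_mem_nhdsWithin] with x hx
      exact (cdf_lt_of_lt_quantile hα.1 hx).le
    linarith
  · have hr : Tendsto (cdf μ) (𝓝[>] q) (𝓝 (cdf μ q)) :=
      ((cdf μ).right_continuous q).tendsto.mono_left (nhdsWithin_mono _ Set.Ioi_subset_Ici_self)
    refine ge_of_tendsto hr ?_
    filter_upwards [self_mem_nhdsWithin] with x hx
    obtain ⟨y, hy, hyx⟩ := exists_lt_of_csInf_lt hne hx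
    exact le_trans hy (monotone_cdf μ hyx.le)

theorem strictMono_cdf_gaussianReal : StrictMono (cdf (gaussianReal 0 1)) := by
  intro a b hab
  have h1 : (gaussianReal 0 1) (Set.Ioc a b) ≠ 0 := fun h => by
    have := gaussianReal_absolutelyContinuous' 0 one_ne_zero h
    simp [Real.volume_Ioc] at this
    linarith
  rw [← measure_cdf (gaussianReal 0 1), StieltjesFunction.measure_Ioc] at h1
  by_contra! h
  exact h1 (ENNReal.ofReal_eq_zero.2 (by linarith))

/-- The event is kept as `σ * t ≤ y` to include `σ = 0`, the point mass at zero that arises when the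
gradient vanishes. -/
theorem gaussianReal_mul_le_lt {α : ℝ} (hα : α ∈ Set.Ioo (0 : ℝ) 1) {σ : ℝ} (hσ : 0 ≤ σ) {y : ℝ}
    (hy : y < normalQuantile α * σ) : (gaussianReal 0 1).real {t | σ * t ≤ y} < α := by
  rcases hσ.eq_or_lt with rfl | h
  · have : {t : ℝ | 0 * t ≤ y} = ∅ := by ext t; simp at hy ⊢; exact hy
    rw [this]; simpa using hα.1
  · have : {t : ℝ | σ * t ≤ y} = Set.Iic (y / σ) := by ext t; simp [le_div_iff₀' h]
    rw [this, ← cdf_eq_real, ← cdf_normalQuantile hα]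
    exact strictMono_cdf_gaussianReal (by rwa [div_lt_iff₀ h])

theorem lt_gaussianReal_mul_le {α : ℝ} (hα : α ∈ Set.Ioo (0 : ℝ) 1) {σ : ℝ} (hσ : 0 ≤ σ) {y : ℝ}
    (hy : normalQuantile α * σ < y) : α < (gaussianReal 0 1).real {t | σ * t ≤ y} := by
  rcases hσ.eq_or_lt with rfl | h
  · have : {t : ℝ | 0 * t ≤ y} = Set.univ := by ext t; simp at hy ⊢; exact hy.le
    rw [this]; simpa using hα.2
  · have : {t : ℝ | σ * t ≤ y} = Set.Iic (y / σ) := by ext t; simp [le_div_iff₀' h]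
    rw [this, ← cdf_eq_real]
    conv_lhs => rw [← cdf_normalQuantile hα]
    exact strictMono_cdf_gaussianReal (by rwa [lt_div_iff₀ h])

end Quantile

/-! ### The deterministic limit theorem for locally quadratic criteria -/

variable {d : ℕ}

/-- A sequence of criterion functions `ℓ k` which, in the local parameter `h = t k (θ - θ₀)`,
approach the quadratic function `h'D₀ - h'J₀h / 2` on the balls of radius `δ k` around `θ₀`,
and for which `exp (ℓ k)` is negligible outside of these balls. -/
structure LocallyQuadratic (Θ : Set (Vec d)) (θ₀ : Vec d) (c : ℝ) (t δ ε m : ℕ → ℝ)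
    (J : ℕ → Matrix (Fin d) (Fin d) ℝ) (J₀ : Matrix (Fin d) (Fin d) ℝ) (D : ℕ → Vec d)
    (D₀ : Vec d) (ℓ : ℕ → Vec d → ℝ) : Prop where
  t_pos : ∀ k, 0 < t k
  t_tendsto : Tendsto t atTop atTop
  radius_tendsto : Tendsto (fun k => δ k * t k) atTop atTop
  error_tendsto : Tendsto ε atTop (𝓝 0)
  tail_nonneg : ∀ k, 0 ≤ m k
  tail_tendsto : Tendsto (fun k => m k * t k ^ d) atTop (𝓝 0)
  coercive : ∀ k, IsCoercive (J k) c
  hessian_tendsto : Tendsto J atTop (𝓝 J₀)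
  score_tendsto : Tendsto D atTop (𝓝 D₀)
  measurable : ∀ k, Measurable fun θ : Θ => ℓ k θ
  near : ∀ k, ∀ θ ∈ Θ, ‖θ - θ₀‖ ≤ δ k →
    |ℓ k θ - (inner ℝ (t k • (θ - θ₀)) (D k) - 1 / 2 * quadForm (J k) (t k • (θ - θ₀)))|
      ≤ ε k * (1 + ‖t k • (θ - θ₀)‖ ^ 2)
  far : ∀ k, ∀ θ ∈ Θ, δ k < ‖θ - θ₀‖ → Real.exp (ℓ k θ) ≤ m k

theorem setIntegral_rescale {t : ℝ} (ht : 0 < t) (θ₀ : Vec d) {A : Set (Vec d)}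
    (hA : MeasurableSet A) (f : Vec d → ℝ) :
    t ^ d * ∫ θ in A, f θ = ∫ h, A.indicator f (θ₀ + t⁻¹ • h) := by
  have h1 := Measure.integral_comp_smul (volume : Measure (Vec d))
    (fun y => A.indicator f (θ₀ + y)) t⁻¹
  rw [h1, integral_add_left_eq_self (fun y => A.indicator f y) θ₀, integral_indicator hA,
    finrank_euclideanSpace_fin, inv_pow, inv_inv, abs_of_pos (pow_pos ht d), smul_eq_mul]

variable {Θ : Set (Vec d)} {θ₀ : Vec d} {c : ℝ} {t δ ε m : ℕ → ℝ}
  {J : ℕ → Matrix (Fin d) (Fin d) ℝ} {J₀ : Matrix (Fin d) (Fin d) ℝ} {D : ℕ → Vec d}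
  {D₀ : Vec d} {ℓ : ℕ → Vec d → ℝ}

theorem LocallyQuadratic.measurable_indicator (H : LocallyQuadratic Θ θ₀ c t δ ε m J J₀ D D₀ ℓ)
    (hΘ : IsCompact Θ) {π : Vec d → ℝ} (hπ : ContinuousOn π Θ) (k : ℕ) :
    Measurable (Θ.indicator fun θ => Real.exp (ℓ k θ) * π θ) := by
  have h1 : Measurable (Θ.domRestrict fun θ => Real.exp (ℓ k θ) * π θ) :=
    (Real.measurable_exp.comp (H.measurable k)).mul hπ.domRestrict.measurable
  refine measurable_of_restrict_of_restrict_compl hΘ.measurableSet ?_ ?_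
  · convert h1 using 1
    ext θ
    simp [Set.domRestrict_apply]
  · convert (measurable_const : Measurable fun _ : (Θᶜ : Set (Vec d)) => (0 : ℝ)) using 1
    ext θ
    exact Set.indicator_of_notMem θ.2 _

theorem LocallyQuadratic.le_near (H : LocallyQuadratic Θ θ₀ c t δ ε m J J₀ D D₀ ℓ) (k : ℕ)
    {θ : Vec d} (hθ : θ ∈ Θ) (hδ : ‖θ - θ₀‖ ≤ δ k) :
    ℓ k θ ≤ inner ℝ (t k • (θ - θ₀)) (D k) - 1 / 2 * quadForm (J k) (t k • (θ - θ₀))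
      + ε k * (1 + ‖t k • (θ - θ₀)‖ ^ 2) := by
  linarith [(abs_le.1 (H.near k θ hθ hδ)).2]

theorem LocallyQuadratic.integrableOn (H : LocallyQuadratic Θ θ₀ c t δ ε m J J₀ D D₀ ℓ)
    (hΘ : IsCompact Θ) {π : Vec d → ℝ} (hπ : ContinuousOn π Θ) (k : ℕ) :
    IntegrableOn (fun θ => Real.exp (ℓ k θ) * π θ) Θ := by
  obtain ⟨Cπ, hCπ⟩ := hΘ.exists_bound_of_continuousOn hπ
  have hq := continuous_quadForm (J k)
  have hcont : Continuous fun θ => inner ℝ (t k • (θ - θ₀)) (D k)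
      - 1 / 2 * quadForm (J k) (t k • (θ - θ₀)) + ε k * (1 + ‖t k • (θ - θ₀)‖ ^ 2) := by
    fun_prop
  obtain ⟨M, hM⟩ := hΘ.exists_bound_of_continuousOn hcont.continuousOn
  rw [← integrable_indicator_iff hΘ.measurableSet]
  have h1 := H.measurable_indicator hΘ hπ k
  have h2 : Integrable (Θ.indicator fun _ => (Real.exp M + m k) * Cπ) :=
    (integrable_indicator_iff hΘ.measurableSet).2
      (integrableOn_const hΘ.measure_lt_top.ne)
  refine h2.mono' h1.aestronglyMeasurable (.of_forall fun θ => ?_)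
  by_cases hθ : θ ∈ Θ
  · rw [Set.indicator_of_mem hθ, Set.indicator_of_mem hθ, norm_mul,
      Real.norm_of_nonneg (Real.exp_nonneg _)]
    have h0 := H.tail_nonneg k
    refine mul_le_mul ?_ (hCπ θ hθ) (norm_nonneg _) (by positivity)
    rcases le_or_gt ‖θ - θ₀‖ (δ k) with h | h
    · have h3 := (H.le_near k hθ h).trans ((le_abs_self _).trans (hM θ hθ))
      linarith [Real.exp_le_exp.2 h3]
    · linarith [H.far k θ hθ h, Real.exp_nonneg M]
  · rw [Set.indicator_of_notMem hθ, Set.indicator_of_notMem hθ, norm_zero]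

/-- After rescaling, the quasi-posterior weights converge to a Gaussian density in total
variation. -/
theorem LocallyQuadratic.tendsto_setIntegral (H : LocallyQuadratic Θ θ₀ c t δ ε m J J₀ D D₀ ℓ)
    (hΘ : IsCompact Θ) (hθ₀ : θ₀ ∈ interior Θ) {π : Vec d → ℝ} (hπ : ContinuousOn π Θ)
    {A : ℕ → Set (Vec d)} (hA : ∀ k, MeasurableSet (A k)) (hAΘ : ∀ k, A k ⊆ Θ)
    {A₀ : Set (Vec d)} (hA₀ : MeasurableSet A₀)
    (hlim : ∀ᵐ h, ∀ᶠ k in atTop, θ₀ + (t k)⁻¹ • h ∈ A k ↔ h ∈ A₀) :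
    Tendsto (fun k => t k ^ d * ∫ θ in A k, Real.exp (ℓ k θ) * π θ) atTop
      (𝓝 (∫ h in A₀, Real.exp (inner ℝ h D₀ - 1 / 2 * quadForm J₀ h) * π θ₀)) := by
  obtain ⟨Cπ, hCπ⟩ := hΘ.exists_bound_of_continuousOn hπ
  have hθ₀Θ : θ₀ ∈ Θ := interior_subset hθ₀
  have hCπ0 : 0 ≤ Cπ := (norm_nonneg _).trans (hCπ θ₀ hθ₀Θ)
  have hcpos : 0 < c := (H.coercive 0).pos
  set w : ℕ → Vec d → ℝ := fun k θ => Real.exp (ℓ k θ) * π θ with hw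
  have hint : ∀ k, IntegrableOn (w k) (A k) := fun k => (H.integrableOn hΘ hπ k).mono_set (hAΘ k)
  let B : ℕ → Set (Vec d) := fun k => Metric.closedBall θ₀ (δ k)
  have hB : ∀ k, MeasurableSet (B k) := fun k => measurableSet_closedBall
  have hmemB : ∀ k θ, θ ∈ B k ↔ ‖θ - θ₀‖ ≤ δ k := fun k θ => by
    rw [Metric.mem_closedBall, dist_eq_norm]
  -- Inside the ball the integral is rescaled to the local parameter; outside it is only estimated.
  have hsplit : ∀ k, t k ^ d * ∫ θ in A k, w k θ
      = (∫ h, (A k ∩ B k).indicator (w k) (θ₀ + (t k)⁻¹ • h))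
        + t k ^ d * ∫ θ in A k \ B k, w k θ := fun k => by
    rw [← setIntegral_rescale (H.t_pos k) θ₀ ((hA k).inter (hB k)), ← mul_add,
      integral_inter_add_sdiff (hB k) (hint k)]
  have hfar : Tendsto (fun k => t k ^ d * ∫ θ in A k \ B k, w k θ) atTop (𝓝 0) := by
    have h1 : Tendsto (fun k => m k * t k ^ d * (Cπ * volume.real Θ)) atTop (𝓝 0) := by
      simpa using H.tail_tendsto.mul_const (Cπ * volume.real Θ)
    refine squeeze_zero_norm (fun k => ?_) h1
    have hfin : volume (A k \ B k) < ∞ :=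
      (measure_mono (Set.sdiff_subset.trans (hAΘ k))).trans_lt hΘ.measure_lt_top
    have h2 : ‖∫ θ in A k \ B k, w k θ‖ ≤ m k * Cπ * volume.real (A k \ B k) := by
      refine norm_setIntegral_le_of_norm_le_const hfin fun θ hθ => ?_
      rw [hw, norm_mul, Real.norm_of_nonneg (Real.exp_nonneg _)]
      refine mul_le_mul (H.far k θ (hAΘ k hθ.1) ?_) (hCπ θ (hAΘ k hθ.1)) (norm_nonneg _)
        (H.tail_nonneg k)
      exact not_le.1 fun h => hθ.2 ((hmemB k θ).2 h)
    have h3 : volume.real (A k \ B k) ≤ volume.real Θ :=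
      measureReal_mono (Set.sdiff_subset.trans (hAΘ k)) hΘ.measure_lt_top.ne
    have h4 := H.tail_nonneg k
    have h5 := H.t_pos k
    rw [norm_mul, Real.norm_of_nonneg (by positivity)]
    calc t k ^ d * ‖∫ θ in A k \ B k, w k θ‖ ≤ t k ^ d * (m k * Cπ * volume.real Θ) := by
          gcongr
          exact h2.trans (by gcongr)
      _ = _ := by ring
  have hscale : ∀ k (h : Vec d), t k • (θ₀ + (t k)⁻¹ • h - θ₀) = h := fun k h => by
    rw [add_sub_cancel_left, smul_smul, mul_inv_cancel₀ (H.t_pos k).ne', one_smul]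
  have hnear : Tendsto (fun k => ∫ h, (A k ∩ B k).indicator (w k) (θ₀ + (t k)⁻¹ • h)) atTop
      (𝓝 (∫ h in A₀, Real.exp (inner ℝ h D₀ - 1 / 2 * quadForm J₀ h) * π θ₀)) := by
    rw [← integral_indicator hA₀]
    obtain ⟨K, hK⟩ : ∃ K, ∀ᶠ k in atTop, ‖D k‖ ≤ K :=
      ⟨‖D₀‖ + 1, H.score_tendsto.norm.eventually_le_const (by linarith)⟩
    -- Coercivity gives decay `c / 2 * ‖h‖²`. An error factor below `c / 4` consumes at most half of
    -- it, and one below `1` keeps the additive constant at most `1`.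
    have hε : ∀ᶠ k in atTop, ε k < min 1 (c / 4) :=
      H.error_tendsto.eventually_lt_const (by positivity)
    refine tendsto_integral_filter_of_dominated_convergence
      (fun h => Real.exp (1 + K * ‖h‖ - c / 4 * ‖h‖ ^ 2) * Cπ) ?_ ?_
      ((integrable_exp_linear_sub_sq (by positivity) 1 K).mul_const Cπ) ?_
    · refine .of_forall fun k => Measurable.aestronglyMeasurable ?_
      have h1 : Measurable ((A k ∩ B k).indicator (w k)) := by
        have h2 := (H.measurable_indicator hΘ hπ k).indicator ((hA k).inter (hB k))
        rwa [Set.indicator_indicator,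
          Set.inter_eq_left.2 (Set.inter_subset_left.trans (hAΘ k))] at h2
      exact h1.comp (by fun_prop)
    · filter_upwards [hK, hε] with k hKk hεk
      refine .of_forall fun h => ?_
      by_cases hmem : θ₀ + (t k)⁻¹ • h ∈ A k ∩ B k
      · rw [Set.indicator_of_mem hmem, hw, norm_mul, Real.norm_of_nonneg (Real.exp_nonneg _)]
        have hΘm := hAΘ k hmem.1
        refine mul_le_mul (Real.exp_le_exp.2 ?_) (hCπ _ hΘm) (norm_nonneg _) (Real.exp_nonneg _)
        have h1 := H.le_near k hΘm ((hmemB k _).1 hmem.2)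
        rw [hscale] at h1
        have h2 := inner_sub_half_quadForm_le (H.coercive k) (D k) h
        have h3 : ‖D k‖ * ‖h‖ ≤ K * ‖h‖ := by gcongr
        have h4 : ε k * ‖h‖ ^ 2 ≤ c / 4 * ‖h‖ ^ 2 := by
          gcongr
          exact hεk.le.trans (min_le_right _ _)
        have h5 : ε k ≤ 1 := hεk.le.trans (min_le_left _ _)
        nlinarith
      · rw [Set.indicator_of_notMem hmem, norm_zero]
        positivity
    · filter_upwards [hlim] with h hh
      have htinv : Tendsto (fun k => (t k)⁻¹) atTop (𝓝 0) := H.t_tendsto.inv_tendsto_atTop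
      have hpt : Tendsto (fun k => θ₀ + (t k)⁻¹ • h) atTop (𝓝 θ₀) := by
        simpa using (htinv.smul_const h).const_add θ₀
      have hball : ∀ᶠ k in atTop, θ₀ + (t k)⁻¹ • h ∈ B k := by
        filter_upwards [H.radius_tendsto.eventually_ge_atTop ‖h‖] with k hk
        rw [hmemB, add_sub_cancel_left, norm_smul, norm_inv, Real.norm_of_nonneg (H.t_pos k).le,
          inv_mul_le_iff₀ (H.t_pos k), mul_comm]
        exact hk
      by_cases hh₀ : h ∈ A₀
      · rw [Set.indicator_of_mem hh₀]
        have hmem : ∀ᶠ k in atTop, θ₀ + (t k)⁻¹ • h ∈ A k ∩ B k := by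
          filter_upwards [hh, hball] with k h1 h2 using ⟨h1.2 hh₀, h2⟩
        have hquad : Tendsto (fun k => inner ℝ h (D k) - 1 / 2 * quadForm (J k) h) atTop
            (𝓝 (inner ℝ h D₀ - 1 / 2 * quadForm J₀ h)) :=
          (tendsto_const_nhds.inner H.score_tendsto).sub
            ((tendsto_quadForm H.hessian_tendsto tendsto_const_nhds).const_mul _)
        have herr : Tendsto (fun k => ε k * (1 + ‖h‖ ^ 2)) atTop (𝓝 0) := by
          simpa using H.error_tendsto.mul_const (1 + ‖h‖ ^ 2)
        have hℓ : Tendsto (fun k => ℓ k (θ₀ + (t k)⁻¹ • h)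
            - (inner ℝ h (D k) - 1 / 2 * quadForm (J k) h)) atTop (𝓝 0) := by
          refine squeeze_zero_norm' ?_ herr
          filter_upwards [hmem] with k hk
          have h1 := H.near k _ (hAΘ k hk.1) ((hmemB k _).1 hk.2)
          rwa [hscale] at h1
        have hℓ' := hℓ.add hquad
        simp only [sub_add_cancel, zero_add] at hℓ'
        have hπ' := (hπ.continuousAt (mem_interior_iff_mem_nhds.1 hθ₀)).tendsto.comp hpt
        refine ((Real.continuous_exp.tendsto _ |>.comp hℓ').mul hπ').congr' ?_
        filter_upwards [hmem] with k hk
        rw [Set.indicator_of_mem hk]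
        rfl
      · rw [Set.indicator_of_notMem hh₀]
        refine tendsto_const_nhds.congr' ?_
        filter_upwards [hh] with k hk
        rw [Set.indicator_of_notMem fun h' => hh₀ (hk.1 h'.1)]
  have := hnear.add hfar
  rw [add_zero] at this
  exact this.congr fun k => (hsplit k).symm

/-- A linear functional with `v ≠ 0` has an atomless Gaussian law, so the hyperplane is
Gaussian-null; the density is positive, so it is also Lebesgue-null. For `v = 0` and `x = 0` the set
would be the whole space. -/
theorem volume_inner_eq {v : Vec d} {x : ℝ} (h : v ≠ 0 ∨ x ≠ 0) :
    volume {z : Vec d | inner ℝ v z = x} = 0 := by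
  by_cases hv : v = 0
  · subst hv
    have : {z : Vec d | inner ℝ (0 : Vec d) z = x} = ∅ := by
      ext z
      simpa using fun h0 => h.resolve_left (fun h => h rfl) h0.symm
    rw [this, measure_empty]
  · have h1 : volume.map (fun z : Vec d => inner ℝ v z) {x} = 0 := by
      have h2 : (stdGaussian (Vec d)).map (fun z => inner ℝ v z) {x} = 0 := by
        rw [stdGaussian_map_inner, gaussianReal_map_const_mul]
        refine gaussianReal_absolutelyContinuous _ ?_ Real.volume_singleton
        simp only [mul_one, ne_eq]
        intro h0
        have := congrArg NNReal.toReal h0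
        simp at this
        exact hv this
      rw [Measure.map_apply (by fun_prop) (measurableSet_singleton x)] at h2 ⊢
      rw [stdGaussian_eq_withDensity, withDensity_apply_eq_zero (by fun_prop)] at h2
      convert h2 using 2
      ext z
      simp only [Set.mem_inter_iff, Set.mem_ofPred_eq, iff_and_self]
      intro _
      have := integral_exp_pos (integrable_exp_neg_mul_sq_norm (d := d) (b := 1 / 2) (by norm_num))
      exact (ENNReal.ofReal_pos.2 (by positivity)).ne'
    rwa [Measure.map_apply (by fun_prop) (measurableSet_singleton x)] at h1

/-- The rescaled quantiles of `g` under the normalized weights `exp (ℓ k) π` converge to the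
quantiles of the limiting Gaussian distribution. -/
theorem LocallyQuadratic.tendsto_quantile (H : LocallyQuadratic Θ θ₀ c t δ ε m J J₀ D D₀ ℓ)
    (hΘ : IsCompact Θ) (hθ₀ : θ₀ ∈ interior Θ) {π : Vec d → ℝ} (hπ : ContinuousOn π Θ)
    (hπpos : ∀ θ ∈ Θ, 0 < π θ) {g : Vec d → ℝ} (hg : ContinuousOn g Θ) {v : Vec d}
    (hgv : HasGradientAt g v θ₀) {α : ℝ} (hα : α ∈ Set.Ioo (0 : ℝ) 1) :
    Tendsto (fun k => t k * (quantile (fun x => (∫ θ in {θ | θ ∈ Θ ∧ g θ ≤ x},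
        Real.exp (ℓ k θ) * π θ) / ∫ θ in Θ, Real.exp (ℓ k θ) * π θ) α - g θ₀)) atTop
      (𝓝 (inner ℝ v (act J₀⁻¹ D₀) + normalQuantile α * √(quadForm J₀⁻¹ v))) := by
  have hJ₀ : IsCoercive J₀ c := isCoercive_of_tendsto H.coercive H.hessian_tendsto
  have hθ₀Θ : θ₀ ∈ Θ := interior_subset hθ₀
  set F : ℕ → ℝ → ℝ := fun k x => (∫ θ in {θ | θ ∈ Θ ∧ g θ ≤ x},
        Real.exp (ℓ k θ) * π θ) / ∫ θ in Θ, Real.exp (ℓ k θ) * π θ with hF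
  have hpt : ∀ h : Vec d, Tendsto (fun k => θ₀ + (t k)⁻¹ • h) atTop (𝓝 θ₀) := fun h => by
    simpa using (H.t_tendsto.inv_tendsto_atTop.smul_const h).const_add θ₀
  have hev : ∀ h : Vec d, ∀ᶠ k in atTop, θ₀ + (t k)⁻¹ • h ∈ Θ := fun h =>
    (hpt h).eventually_mem (mem_interior_iff_mem_nhds.1 hθ₀)
  have hmeas : ∀ x, MeasurableSet {θ | θ ∈ Θ ∧ g θ ≤ x} := fun x =>
    (hg.preimage_isClosed_of_isClosed hΘ.isClosed isClosed_Iic).measurableSet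
  have hnonneg : ∀ k, ∀ θ ∈ Θ, 0 ≤ Real.exp (ℓ k θ) * π θ := fun k θ hθ =>
    mul_nonneg (Real.exp_nonneg _) (hπpos θ hθ).le
  have hmono : ∀ k, Monotone (F k) := fun k x y hxy => by
    refine div_le_div_of_nonneg_right ?_ (setIntegral_nonneg hΘ.measurableSet (hnonneg k))
    refine setIntegral_mono_set ((H.integrableOn hΘ hπ k).mono_set fun θ hθ => hθ.1) ?_
      (Eventually.of_forall fun θ hθ => ⟨hθ.1, hθ.2.trans hxy⟩)
    filter_upwards [ae_restrict_mem (hmeas y)] with θ hθ using hnonneg k θ hθ.1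
  set I := ∫ h, Real.exp (inner ℝ h D₀ - 1 / 2 * quadForm J₀ h) with hI
  have hIpos : 0 < I := integral_exp_pos (integrable_exp_inner_sub_quadForm hJ₀ D₀)
  have hden : Tendsto (fun k => t k ^ d * ∫ θ in Θ, Real.exp (ℓ k θ) * π θ) atTop
      (𝓝 (I * π θ₀)) := by
    have h1 := H.tendsto_setIntegral hΘ hθ₀ hπ (fun _ => hΘ.measurableSet) (fun _ => subset_rfl)
      MeasurableSet.univ (.of_forall fun h => by simpa using hev h)
    rwa [setIntegral_univ, integral_mul_const] at h1
  have hlim : ∀ x, (v ≠ 0 ∨ x ≠ 0) → Tendsto (fun k => F k (g θ₀ + (t k)⁻¹ * x)) atTop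
      (𝓝 ((gaussianReal 0 1).real
        {s | √(quadForm J₀⁻¹ v) * s ≤ x - inner ℝ v (act J₀⁻¹ D₀)})) := fun x hx => by
    have h1 := H.tendsto_setIntegral hΘ hθ₀ hπ
      (A := fun k => {θ | θ ∈ Θ ∧ g θ ≤ g θ₀ + (t k)⁻¹ * x}) (A₀ := {h | inner ℝ v h ≤ x})
      (fun k => hmeas _) (fun k θ hθ => hθ.1) (measurableSet_le (by fun_prop) (by fun_prop)) (by
        -- Off the limiting hyperplane the difference quotients of `g` converge to `v'h ≠ x`, so
        -- they eventually lie on the same side of `x`.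
        have hae : ∀ᵐ h : Vec d, inner ℝ v h ≠ x := by
          rw [ae_iff]; simpa using volume_inner_eq hx
        filter_upwards [hae] with h hh
        have hder := hgv.hasFDerivAt.lim h (c := t) (l := atTop)
          (tendsto_norm_atTop_atTop.comp H.t_tendsto)
        rw [InnerProductSpace.toDual_apply_apply] at hder
        have hiff : ∀ k, g (θ₀ + (t k)⁻¹ • h) ≤ g θ₀ + (t k)⁻¹ * x ↔
            t k • (g (θ₀ + (t k)⁻¹ • h) - g θ₀) ≤ x := fun k => by
          rw [smul_eq_mul, ← le_inv_mul_iff₀ (H.t_pos k), sub_le_iff_le_add']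
        rcases lt_or_gt_of_ne hh with h' | h'
        · filter_upwards [hev h, hder.eventually_lt_const h'] with k h2 h3
          simp only [hiff]
          exact ⟨fun _ => h'.le, fun _ => ⟨h2, h3.le⟩⟩
        · filter_upwards [hder.eventually_const_lt h'] with k h3
          simp only [hiff]
          exact ⟨fun h4 => absurd h4.2 (not_le.2 h3), fun h4 => absurd h4 (not_le.2 h')⟩)
    rw [integral_mul_const] at h1
    have h2 := h1.div hden (mul_pos hIpos (hπpos θ₀ hθ₀Θ)).ne'
    rw [mul_div_mul_right _ _ (hπpos θ₀ hθ₀Θ).ne', setIntegral_exp_div_integral hJ₀] at h2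
    refine h2.congr fun k => ?_
    exact mul_div_mul_left _ _ (pow_pos (H.t_pos k) d).ne'
  set a := inner ℝ v (act J₀⁻¹ D₀) + normalQuantile α * √(quadForm J₀⁻¹ v) with ha
  -- If `v = 0` then `a = 0`, so the excluded pair `v = 0`, `x = 0` can only occur at the limiting
  -- quantile itself, which is never used as an evaluation point.
  have hne : ∀ x, x ≠ a → v ≠ 0 ∨ x ≠ 0 := fun x hx => by
    by_contra! h
    refine hx ?_
    rw [ha, h.1, h.2]
    simp [quadForm]
  have hσ := Real.sqrt_nonneg (quadForm J₀⁻¹ v)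
  rw [Metric.tendsto_nhds]
  intro η hη
  -- The limiting distribution function is strictly below `α` left of `a` and strictly above it to
  -- the right, which traps the quantiles.
  have hlow := (hlim (a - η / 2) (hne _ (by linarith))).eventually_lt_const
    (gaussianReal_mul_le_lt hα hσ (by linarith))
  have hupp := (hlim (a + η / 2) (hne _ (by linarith))).eventually_const_lt
    (lt_gaussianReal_mul_le hα hσ (by linarith))
  filter_upwards [hlow, hupp] with k h1 h2
  have h3 := quantile_mem_Icc (hmono k) h1 h2.le
  rw [Set.mem_Icc, ← le_sub_iff_add_le', ← sub_le_iff_le_add', inv_mul_le_iff₀ (H.t_pos k),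
    le_inv_mul_iff₀ (H.t_pos k)] at h3
  rw [Real.dist_eq, abs_lt]
  constructor <;> linarith [h3.1, h3.2]

/-! ### From outer probability to deterministic sequences -/

section Probability

variable {d : ℕ} {S : Type*} [MeasurableSpace S] {P : Measure S}

theorem BoundedUniformlyPosDef.exists_isCoercive {A : ℕ → Matrix (Fin d) (Fin d) ℝ}
    (h : BoundedUniformlyPosDef A) : ∃ c, ∀ n, IsCoercive (A n) c := by
  obtain ⟨c, hc, hle⟩ := h.posDef
  exact ⟨c, fun n => ⟨h.symm n, hc, hle n⟩⟩

/-- If, up to events of arbitrarily small probability, no sequence of sample points along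
increasing indices lies in the events `A n`, then `P (A n)` tends to zero. -/
theorem tendsto_measure_zero_of_no_sequence {A : ℕ → Set S}
    (h : ∀ ρ : ℝ≥0∞, 0 < ρ → ∃ G : ℕ → ℕ → Set S, (∀ k, ∀ᶠ n in atTop, P (G k n)ᶜ < ρ) ∧
      ∀ (ns : ℕ → ℕ) (s : ℕ → S), (∀ k, s k ∈ G k (ns k)) → (∀ k, s k ∈ A (ns k)) → False) :
    Tendsto (fun n => P (A n)) atTop (𝓝 0) := by
  rw [ENNReal.tendsto_nhds_zero]
  intro ρ hρ
  by_contra hcon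
  obtain ⟨G, hG, hno⟩ := h ρ hρ
  have hex : ∀ k, ∃ n s, s ∈ G k n ∧ s ∈ A n := fun k => by
    obtain ⟨n, hn1, hn2⟩ := ((not_eventually.1 hcon).and_eventually (hG k)).exists
    -- If `G k n` and `A n` were disjoint, `A n` would lie in the complement of `G k n` and have
    -- outer measure below `ρ`.
    by_contra! hempty
    exact absurd ((measure_mono fun s hs hs' => hempty n s hs' hs).trans hn2.le) hn1
  choose ns s hs1 hs2 using hex
  exact hno ns s hs1 hs2

variable {Θ : Set (Vec d)} {θ₀ : Vec d} {L : ℕ → Vec d → S → ℝ} {Δ : ℕ → S → Vec d}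
  {J Ω : ℕ → Matrix (Fin d) (Fin d) ℝ}

/-- Beyond `M / √n` the remainder is at most `ε n ‖θ - θ₀‖²`, within it at most `ε`; the sum of the
two bounds covers both ranges. -/
theorem ExpansionAssumption.eventually_remainder_le [IsProbabilityMeasure P]
    (h : ExpansionAssumption P Θ θ₀ L Δ J Ω) {ε : ℝ} (hε : 0 < ε) {ρ : ℝ≥0∞} (hρ : 0 < ρ) :
    ∃ δ : ℝ, 0 < δ ∧ ∀ᶠ n : ℕ in atTop, P {s | ∀ θ ∈ Θ, ‖θ - θ₀‖ ≤ δ →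
      |remainder θ₀ L Δ J n s θ| ≤ ε * (1 + n * ‖θ - θ₀‖ ^ 2)}ᶜ < ρ := by
  obtain ⟨r, hr0, hr⟩ : ∃ r : ℝ, 0 < r ∧ ENNReal.ofReal r + ENNReal.ofReal r ≤ ρ := by
    rcases eq_or_ne ρ ∞ with rfl | htop
    · exact ⟨1, one_pos, le_top⟩
    · refine ⟨(ρ / 2).toReal, ENNReal.toReal_pos (ENNReal.half_pos hρ.ne').ne'
        (ENNReal.div_ne_top htop (by norm_num)), ?_⟩
      rw [ENNReal.ofReal_toReal (ENNReal.div_ne_top htop (by norm_num)), ENNReal.add_halves]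
  -- The assumption uses one number for both accuracy and probability. The choice `min ε r` with `2
  -- r ≤ ρ` serves both and pays for the two exceptional events.
  have he : 0 < min ε r := lt_min hε hr0
  obtain ⟨δ, hδ, M, hM, h1, h2⟩ := h.remainder_small (min ε r) he
  refine ⟨δ, hδ, ?_⟩
  have h2' := eventually_lt_of_limsup_lt (h2.trans_lt (ENNReal.ofReal_pos.2 he))
  filter_upwards [eventually_lt_of_limsup_lt h1, h2', eventually_gt_atTop 0] with n hn1 hn2 hn
  have hn0 : (0 : ℝ) < n := by exact_mod_cast hn
  refine lt_of_le_of_lt ?_ ((ENNReal.add_lt_add hn1 hn2).trans_le ((add_le_add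
    (ENNReal.ofReal_le_ofReal (min_le_right _ _))
    (ENNReal.ofReal_le_ofReal (min_le_right _ _))).trans hr))
  refine (measure_mono fun s hs => ?_).trans (measure_union_le _ _)
  simp only [Set.mem_compl_iff, Set.mem_ofPred_eq, not_forall, not_le] at hs
  obtain ⟨θ, hθ, hθδ, hbig⟩ := hs
  have hle := min_le_left ε r
  rcases le_or_gt (M / √n) ‖θ - θ₀‖ with hcase | hcase
  · left
    refine ⟨θ, hθ, hcase, hθδ, ?_⟩
    have hpos : 0 < ‖θ - θ₀‖ := lt_of_lt_of_le (by positivity) hcase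
    rw [lt_div_iff₀ (by positivity)]
    have : 0 < (n : ℝ) * ‖θ - θ₀‖ ^ 2 := by positivity
    nlinarith
  · right
    refine ⟨θ, hθ, hcase.le, ?_⟩
    have : 0 ≤ (n : ℝ) * ‖θ - θ₀‖ ^ 2 := by positivity
    nlinarith

theorem IdentifiabilityAssumption.exists_eventually [IsProbabilityMeasure P]
    (h : IdentifiabilityAssumption P Θ θ₀ L) {δ : ℝ} (hδ : 0 < δ) :
    ∃ κ : ℝ, 0 < κ ∧ ∀ ρ : ℝ≥0∞, 0 < ρ → ∀ᶠ n : ℕ in atTop, P {s | ∀ θ ∈ Θ, δ ≤ ‖θ - θ₀‖ →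
      (1 / (n : ℝ)) * (L n θ s - L n θ₀ s) ≤ -κ}ᶜ < ρ := by
  obtain ⟨κ, hκ, hlim⟩ := h δ hδ
  refine ⟨κ, hκ, fun ρ hρ => ?_⟩
  have h1 : 1 - ρ < liminf (fun n : ℕ => innerProb P {s | ∀ θ ∈ Θ, δ ≤ ‖θ - θ₀‖ →
      (1 / (n : ℝ)) * (L n θ s - L n θ₀ s) ≤ -κ}) atTop := by
    rw [hlim]
    exact ENNReal.sub_lt_self ENNReal.one_ne_top one_ne_zero hρ.ne'
  filter_upwards [eventually_lt_of_lt_liminf h1] with n hn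
  by_contra! hcon
  exact absurd hn (not_lt.2 (tsub_le_tsub_left hcon 1))

/-- The normalized scores are uniformly tight. -/
theorem ExpansionAssumption.score_tight [IsProbabilityMeasure P]
    (h : ExpansionAssumption P Θ θ₀ L Δ J Ω) {ρ : ℝ≥0∞} (hρ : 0 < ρ) :
    ∃ K : ℝ, ∀ᶠ n : ℕ in atTop, P {s | ‖(√(n : ℝ))⁻¹ • Δ n s‖ ≤ K}ᶜ < ρ := by
  obtain ⟨c, hc⟩ := h.variance.exists_isCoercive
  obtain ⟨C, hC0, hC⟩ := exists_norm_act_le h.variance.bounded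
  have hcpos := (hc 0).pos
  have htail : Tendsto (fun N : ℕ => stdGaussian (Vec d) {w | (N : ℝ) ≤ ‖w‖}) atTop (𝓝 0) := by
    have h1 := tendsto_measure_iInter_atTop (μ := stdGaussian (Vec d))
      (s := fun N : ℕ => {w : Vec d | (N : ℝ) ≤ ‖w‖})
      (fun N => (measurableSet_le (by fun_prop) (by fun_prop)).nullMeasurableSet)
      (fun i j hij w hw => (Nat.cast_le.2 hij : (i : ℝ) ≤ j).trans hw) ⟨0, measure_ne_top _ _⟩
    have h2 : ⋂ N : ℕ, {w : Vec d | (N : ℝ) ≤ ‖w‖} = ∅ := by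
      refine Set.eq_empty_iff_forall_notMem.2 fun w hw => ?_
      obtain ⟨N, hN⟩ := exists_nat_gt ‖w‖
      exact absurd (Set.mem_iInter.1 hw N) (not_le.2 hN)
    rwa [h2, measure_empty] at h1
  obtain ⟨N, hN⟩ := (htail.eventually_lt_const hρ).exists
  -- Since `‖Ω^{-1/2} D‖ ≥ (√c / C) ‖D‖`, a score beyond this radius has a whitened version of norm
  -- at least `N`.
  refine ⟨C * N / √c, ?_⟩
  have hclosed : IsClosed {w : Vec d | (N : ℝ) ≤ ‖w‖} :=
    isClosed_le continuous_const continuous_norm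
  have hport := ProbabilityMeasure.limsup_measure_closed_le_of_tendsto h.score_tendsto.tendsto
    hclosed
  simp only [ProbabilityMeasure.coe_mk, Measure.map_id] at hport
  filter_upwards [eventually_lt_of_limsup_lt (hport.trans_lt hN)] with n hn
  rw [Measure.map_apply_of_aemeasurable (h.score_tendsto.forall_aemeasurable n)
    hclosed.measurableSet] at hn
  refine (measure_mono fun s hs => ?_).trans_lt hn
  simp only [Set.mem_compl_iff, Set.mem_ofPred_eq, not_le] at hs
  simp only [Set.mem_preimage, Set.mem_ofPred_eq]
  set D := (√(n : ℝ))⁻¹ • Δ n s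
  have h1 := (hc n).quadForm_inv_ge (hC n) hC0 D
  rw [← (hc n).norm_act_invRoot_sq] at h1
  have h2 : √c * (C⁻¹ * ‖D‖) ≤ ‖act (invRoot (Ω n)) D‖ := by
    refine le_of_sq_le_sq ?_ (norm_nonneg _)
    rw [mul_pow, Real.sq_sqrt hcpos.le]
    exact h1
  refine le_trans ?_ h2
  rw [div_lt_iff₀ (Real.sqrt_pos.2 hcpos)] at hs
  rw [← mul_assoc, mul_comm (√c), mul_assoc, le_inv_mul_iff₀ hC0]
  linarith

theorem tendsto_exp_neg_mul_sqrt_pow {κ : ℝ} (hκ : 0 < κ) (d : ℕ) :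
    Tendsto (fun n : ℕ => Real.exp (-(n * κ)) * √(n : ℝ) ^ d) atTop (𝓝 0) := by
  have h1 := tendsto_pow_const_mul_const_pow_of_abs_lt_one d (r := Real.exp (-κ))
    (by rw [abs_of_pos (Real.exp_pos _), ← Real.exp_zero]; exact Real.exp_lt_exp.2 (by linarith))
  refine squeeze_zero' (.of_forall fun n => by positivity) ?_ h1
  filter_upwards [eventually_ge_atTop 1] with n hn
  have hn1 : (1 : ℝ) ≤ n := by exact_mod_cast hn
  rw [← Real.exp_nat_mul, mul_comm ((n : ℝ) ^ d), mul_neg]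
  gcongr
  exact Real.sqrt_le_iff.2 ⟨by linarith, by nlinarith⟩

/-- To see that `P (A n)` tends to zero, it is enough to exclude sequences of sample points in
the events `A n` along which the criterion functions are locally quadratic. -/
theorem tendsto_measure_zero_of_locallyQuadratic [IsProbabilityMeasure P]
    (hmeas : MeasurabilityAssumption Θ L Δ) (hident : IdentifiabilityAssumption P Θ θ₀ L)
    (hexp : ExpansionAssumption P Θ θ₀ L Δ J Ω) {c : ℝ} (hc : ∀ n, IsCoercive (J n) c)
    {X : ℕ → S → Vec d} (hX : IsLittleOP P X fun _ => 1) {A : ℕ → Set S}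
    (hA : ∀ (ns : ℕ → ℕ) (s : ℕ → S) (δ ε m : ℕ → ℝ) (J₀ : Matrix (Fin d) (Fin d) ℝ)
      (D₀ : Vec d), (∀ k, s k ∈ A (ns k)) →
      Tendsto (fun k => X (ns k) (s k)) atTop (𝓝 0) →
      LocallyQuadratic Θ θ₀ c (fun k => √(ns k : ℝ)) δ ε m (fun k => J (ns k)) J₀
        (fun k => (√(ns k : ℝ))⁻¹ • Δ (ns k) (s k)) D₀
        (fun k θ => L (ns k) θ (s k) - L (ns k) θ₀ (s k)) → False) :
    Tendsto (fun n => P (A n)) atTop (𝓝 0) := by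
  refine tendsto_measure_zero_of_no_sequence fun ρ hρ => ?_
  have hρ4 : 0 < ρ / 4 := ENNReal.div_pos hρ.ne' (by norm_num)
  set ε : ℕ → ℝ := fun k => 1 / ((k : ℝ) + 1) with hε
  have hεpos : ∀ k, 0 < ε k := fun k => by positivity
  have hε0 : Tendsto ε atTop (𝓝 0) := tendsto_one_div_add_atTop_nhds_zero_nat
  obtain ⟨K, hK⟩ := hexp.score_tight hρ4
  choose δ hδ hrem using fun k => hexp.eventually_remainder_le (hεpos k) hρ4
  choose κ hκ hfar using fun k => hident.exists_eventually (hδ k)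
  let G₁ : ℕ → Set S := fun n => {s | ‖(√(n : ℝ))⁻¹ • Δ n s‖ ≤ K}
  let G₂ : ℕ → ℕ → Set S := fun k n => {s | ∀ θ ∈ Θ, ‖θ - θ₀‖ ≤ δ k →
      |remainder θ₀ L Δ J n s θ| ≤ ε k * (1 + n * ‖θ - θ₀‖ ^ 2)}
  let G₃ : ℕ → ℕ → Set S := fun k n => {s | ∀ θ ∈ Θ, δ k ≤ ‖θ - θ₀‖ →
      (1 / (n : ℝ)) * (L n θ s - L n θ₀ s) ≤ -κ k}
  let G₄ : ℕ → ℕ → Set S := fun k n => {s | ‖X n s‖ ≤ ε k}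
  -- The radius `δ k` and the rate `κ k` may shrink with `k`. Each index `n` is chosen after them,
  -- so large that the rescaled radius still diverges and the tail beats the factor `√n ^ d`.
  let N : ℕ → ℕ → Prop := fun k n => k + 1 ≤ n ∧ (k : ℝ) ≤ δ k * √(n : ℝ) ∧
    Real.exp (-(n * κ k)) * √(n : ℝ) ^ d ≤ ε k
  have hX' : ∀ k, ∀ᶠ n in atTop, P (G₄ k n)ᶜ < ρ / 4 := fun k => by
    have h1 := tendstoInMeasure_iff_norm.1 hX (ε k) (hεpos k)
    filter_upwards [h1.eventually_lt_const hρ4] with n hn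
    refine (measure_mono fun s hs => ?_).trans_lt hn
    simp only [G₄, Set.mem_compl_iff, Set.mem_ofPred_eq, not_le] at hs
    simpa using hs.le
  have hN : ∀ k, ∀ᶠ n in atTop, N k n := fun k => by
    have hsqrt : Tendsto (fun n : ℕ => δ k * √(n : ℝ)) atTop atTop :=
      (Real.tendsto_sqrt_atTop.comp tendsto_natCast_atTop_atTop).const_mul_atTop (hδ k)
    exact (eventually_ge_atTop (k + 1)).and ((hsqrt.eventually_ge_atTop _).and
      ((tendsto_exp_neg_mul_sqrt_pow (hκ k) d).eventually_le_const (hεpos k)))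
  refine ⟨fun k n => (G₁ n ∩ G₂ k n) ∩ (G₃ k n ∩ G₄ k n) ∩ {_s | N k n}, fun k => ?_, ?_⟩
  · filter_upwards [hK, hrem k, hfar k _ hρ4, hX' k, hN k] with n h1 h2 h3 h4 h5
    have hu : ({_s | N k n} : Set S) = Set.univ := Set.eq_univ_of_forall fun _ => h5
    rw [hu, Set.inter_univ, Set.compl_inter, Set.compl_inter, Set.compl_inter]
    have h6 := ENNReal.add_lt_add (ENNReal.add_lt_add h1 h2) (ENNReal.add_lt_add h3 h4)
    have h7 : ρ / 4 + ρ / 4 + (ρ / 4 + ρ / 4) = ρ := by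
      have : ρ / 4 = ρ / 2 / 2 := by
        rw [div_eq_mul_inv, div_eq_mul_inv, div_eq_mul_inv, mul_assoc,
          ← ENNReal.mul_inv (by norm_num) (by norm_num)]
        norm_num
      rw [this, ENNReal.add_halves, ENNReal.add_halves]
    rw [h7] at h6
    exact ((measure_union_le _ _).trans (add_le_add (measure_union_le _ _)
      (measure_union_le _ _))).trans_lt h6
  · intro ns s hG hsA
    -- Boundedness of `J` and the bound `K` on the scores, valid at every chosen sample point, yield
    -- a common convergent subsequence.
    obtain ⟨J₀, φ, hφ, hJ₀⟩ := exists_subseq_tendsto_matrix hexp.hessian.bounded ns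
    obtain ⟨D₀, -, ψ, hψ, hD₀⟩ := tendsto_subseq_of_bounded
      (Metric.isBounded_closedBall (x := (0 : Vec d)) (r := K))
      (x := fun k => (√(ns (φ k) : ℝ))⁻¹ • Δ (ns (φ k)) (s (φ k)))
      (fun k => mem_closedBall_zero_iff.2 (hG (φ k)).1.1.1)
    set χ : ℕ → ℕ := fun k => φ (ψ k) with hχ
    have hχtop : Tendsto χ atTop atTop := (hφ.comp hψ).tendsto_atTop
    have hkχ : ∀ k, k ≤ χ k := fun k => (hφ.comp hψ).le_apply
    have hNχ : ∀ k, N (χ k) (ns (χ k)) := fun k => (hG (χ k)).2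
    have hpos : ∀ k, (0 : ℝ) < ns (χ k) := fun k => by
      exact_mod_cast (Nat.succ_pos _).trans_le (hNχ k).1
    have hεχ : Tendsto (fun k => ε (χ k)) atTop (𝓝 0) := hε0.comp hχtop
    refine hA (fun k => ns (χ k)) (fun k => s (χ k)) (fun k => δ (χ k)) (fun k => ε (χ k))
      (fun k => Real.exp (-(ns (χ k) * κ (χ k)))) J₀ D₀ (fun k => hsA _)
      (squeeze_zero_norm (fun k => (hG (χ k)).1.2.2) hεχ) ?_
    refine
      { t_pos := fun k => Real.sqrt_pos.2 (hpos k)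
        t_tendsto := ?_
        radius_tendsto := ?_
        error_tendsto := hεχ
        tail_nonneg := fun k => Real.exp_nonneg _
        tail_tendsto := squeeze_zero (fun k => by positivity) (fun k => (hNχ k).2.2) hεχ
        coercive := fun k => hc _
        hessian_tendsto := hJ₀.comp hψ.tendsto_atTop
        score_tendsto := hD₀
        measurable := fun k => (hmeas.parameter _ _).sub_const _
        near := fun k θ hθ hd => ?_
        far := fun k θ hθ hd => ?_ }
    · refine Real.tendsto_sqrt_atTop.comp (tendsto_natCast_atTop_atTop.comp ?_)
      exact tendsto_atTop_mono (fun k => (hkχ k).trans ((Nat.le_succ _).trans (hNχ k).1))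
        tendsto_id
    · exact tendsto_atTop_mono (fun k => le_trans (by exact_mod_cast hkχ k) (hNχ k).2.1)
        tendsto_natCast_atTop_atTop
    · have h1 := (hG (χ k)).1.1.2 θ hθ hd
      have hs := Real.sqrt_pos.2 (hpos k)
      rw [inner_smul_left, inner_smul_right, conj_trivial, mul_inv_cancel_left₀ hs.ne',
        quadForm_smul, norm_smul, mul_pow, Real.norm_of_nonneg hs.le,
        Real.sq_sqrt (hpos k).le]
      rw [remainder, quadForm_smul_left] at h1
      convert h1 using 2
      ring
    · have h1 := (hG (χ k)).1.2.1 θ hθ hd.le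
      rw [one_div, inv_mul_le_iff₀ (hpos k)] at h1
      exact Real.exp_le_exp.2 (by linarith)

end Probability

/-! ### The expansion of the quasi-posterior quantiles -/

section LargeSample

/-- The factor `exp (L n θ₀ s)` cancels in the normalization, so only differences of the criterion
matter. -/
theorem quasiQuantile_eq {d : ℕ} {S : Type*} (Θ : Set (Vec d)) (θ₀ : Vec d) (π : Vec d → ℝ)
    (L : ℕ → Vec d → S → ℝ) (g : Vec d → ℝ) (n : ℕ) (s : S) (α : ℝ) :
    quasiQuantile Θ π L g n s α = quantile (fun x => (∫ θ in {θ | θ ∈ Θ ∧ g θ ≤ x},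
        Real.exp (L n θ s - L n θ₀ s) * π θ)
          / ∫ θ in Θ, Real.exp (L n θ s - L n θ₀ s) * π θ) α := by
  have h : ∀ θ, Real.exp (L n θ s) * π θ
      = Real.exp (L n θ₀ s) * (Real.exp (L n θ s - L n θ₀ s) * π θ) := fun θ => by
    rw [← mul_assoc, ← Real.exp_add, add_sub_cancel]
  rw [quasiQuantile]
  congr 1
  funext x
  simp only [quasiCDF, quasiPosterior]
  rw [integral_div]
  simp_rw [h, integral_const_mul]
  exact mul_div_mul_left _ _ (Real.exp_pos _).ne'

variable {d : ℕ} {S : Type*} {Θ : Set (Vec d)} {θ₀ : Vec d} {π : Vec d → ℝ}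
  {L : ℕ → Vec d → S → ℝ} {Δ : ℕ → S → Vec d} {J Ω : ℕ → Matrix (Fin d) (Fin d) ℝ}

theorem LocallyQuadratic.tendsto_quasiQuantile {c : ℝ} {t δ ε m : ℕ → ℝ} {ns : ℕ → ℕ} {s : ℕ → S}
    {A : ℕ → Matrix (Fin d) (Fin d) ℝ} {J₀ : Matrix (Fin d) (Fin d) ℝ} {D : ℕ → Vec d} {D₀ : Vec d}
    (H : LocallyQuadratic Θ θ₀ c t δ ε m A J₀ D D₀
      (fun k θ => L (ns k) θ (s k) - L (ns k) θ₀ (s k)))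
    (hparam : ParameterAssumption Θ θ₀) (hprior : PriorAssumption Θ π)
    {g : Vec d → ℝ} (hg : ContDiffOn ℝ 1 g Θ) {α : ℝ} (hα : α ∈ Set.Ioo (0 : ℝ) 1) :
    Tendsto (fun k => t k * (quasiQuantile Θ π L g (ns k) (s k) α - g θ₀)) atTop
      (𝓝 (inner ℝ (gradient g θ₀) (act J₀⁻¹ D₀)
        + normalQuantile α * √(quadForm J₀⁻¹ (gradient g θ₀)))) := by
  obtain ⟨c', hc', hle⟩ := hprior.uniformly_pos
  have hdiff : DifferentiableAt ℝ g θ₀ :=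
    (hg.contDiffAt (mem_interior_iff_mem_nhds.1 hparam.mem_interior)).differentiableAt one_ne_zero
  simp_rw [fun k => quasiQuantile_eq Θ θ₀ π L g (ns k) (s k) α]
  exact H.tendsto_quantile hparam.isCompact hparam.mem_interior hprior.continuousOn
    (fun θ hθ => hc'.trans_le (hle θ hθ)) hg.continuousOn hdiff.hasGradientAt hα

theorem LocallyQuadratic.tendsto_sqrt_quadForm_inv {c : ℝ} {t δ ε m : ℕ → ℝ}
    {A : ℕ → Matrix (Fin d) (Fin d) ℝ} {J₀ : Matrix (Fin d) (Fin d) ℝ} {D : ℕ → Vec d} {D₀ : Vec d}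
    {ℓ : ℕ → Vec d → ℝ} (H : LocallyQuadratic Θ θ₀ c t δ ε m A J₀ D D₀ ℓ) (v : Vec d) :
    Tendsto (fun k => √(quadForm (A k)⁻¹ v)) atTop (𝓝 √(quadForm J₀⁻¹ v)) :=
  (tendsto_quadForm (tendsto_matrix_inv (isCoercive_of_tendsto H.coercive
    H.hessian_tendsto).isUnit_det H.hessian_tendsto) tendsto_const_nhds).sqrt

theorem LocallyQuadratic.tendsto_act_inv {c : ℝ} {t δ ε m : ℕ → ℝ}
    {A : ℕ → Matrix (Fin d) (Fin d) ℝ} {J₀ : Matrix (Fin d) (Fin d) ℝ} {D : ℕ → Vec d} {D₀ : Vec d}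
    {ℓ : ℕ → Vec d → ℝ} (H : LocallyQuadratic Θ θ₀ c t δ ε m A J₀ D D₀ ℓ) :
    Tendsto (fun k => act (A k)⁻¹ (D k)) atTop (𝓝 (act J₀⁻¹ D₀)) :=
  tendsto_act (tendsto_matrix_inv (isCoercive_of_tendsto H.coercive
    H.hessian_tendsto).isUnit_det H.hessian_tendsto) H.score_tendsto

variable [MeasurableSpace S] {P : Measure S}

theorem isLittleOP_iff {E : Type*} [NormedAddCommGroup E] [NormedSpace ℝ E] {X : ℕ → S → E}
    {r : ℕ → ℝ} : IsLittleOP P X r ↔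
      ∀ η : ℝ, 0 < η → Tendsto (fun n => P {s | η ≤ ‖(r n)⁻¹ • X n s‖}) atTop (𝓝 0) := by
  simp only [IsLittleOP, tendstoInMeasure_iff_norm, sub_zero]

theorem isLittleOP_quasiQuantile_sub [IsProbabilityMeasure P]
    (hmeas : MeasurabilityAssumption Θ L Δ) (hparam : ParameterAssumption Θ θ₀)
    (hprior : PriorAssumption Θ π) (hident : IdentifiabilityAssumption P Θ θ₀ L)
    (hexp : ExpansionAssumption P Θ θ₀ L Δ J Ω) {g : Vec d → ℝ} (hg : ContDiffOn ℝ 1 g Θ)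
    {α : ℝ} (hα : α ∈ Set.Ioo (0 : ℝ) 1) {θhat : ℕ → S → Vec d}
    (hθhat : IsLittleOP P
      (fun n s => √(n : ℝ) • (θhat n s - θ₀) - (√(n : ℝ))⁻¹ • act (J n)⁻¹ (Δ n s))
      (fun _ => 1)) :
    IsLittleOP P
      (fun n s => quasiQuantile Θ π L g n s α - g (θhat n s)
        - normalQuantile α * (√(quadForm (J n)⁻¹ (gradient g θ₀)) / √(n : ℝ)))
      (fun n => 1 / √(n : ℝ)) := by
  obtain ⟨c, hc⟩ := hexp.hessian.exists_isCoercive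
  have hdiff : DifferentiableAt ℝ g θ₀ :=
    (hg.contDiffAt (mem_interior_iff_mem_nhds.1 hparam.mem_interior)).differentiableAt one_ne_zero
  set v := gradient g θ₀ with hv
  rw [isLittleOP_iff]
  intro η hη
  refine tendsto_measure_zero_of_locallyQuadratic hmeas hident hexp hc hθhat ?_
  intro ns s δ ε m J₀ D₀ hsA hX H
  have hlin : Tendsto (fun k => √(ns k : ℝ) • (θhat (ns k) (s k) - θ₀)) atTop
      (𝓝 (act J₀⁻¹ D₀)) := by
    have h1 := hX.add H.tendsto_act_inv
    simp only [act_smul, sub_add_cancel, zero_add] at h1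
    exact h1
  -- The delta method along the sequence. Differentiability at the interior point `θ₀` suffices, so
  -- the estimator need not take values in `Θ`.
  have hgθ : Tendsto (fun k => √(ns k : ℝ) • (g (θhat (ns k) (s k)) - g θ₀)) atTop
      (𝓝 (inner ℝ v (act J₀⁻¹ D₀))) := by
    have hto : Tendsto (fun k => θhat (ns k) (s k) - θ₀) atTop (𝓝 0) := by
      have h2 := H.t_tendsto.inv_tendsto_atTop.smul hlin
      rw [zero_smul] at h2
      refine h2.congr fun k => ?_
      simp only [Pi.inv_apply]
      rw [smul_smul, inv_mul_cancel₀ (H.t_pos k).ne', one_smul]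
    have h1 := hdiff.hasGradientAt.hasFDerivAt.hasFDerivWithinAt (s := Set.univ)
    have h3 := HasFDerivWithinAt.lim h1 (c := fun k => √(ns k : ℝ))
      (d := fun k => θhat (ns k) (s k) - θ₀) (l := atTop) hto (.of_forall fun _ => trivial) hlin
    rw [InnerProductSpace.toDual_apply_apply] at h3
    simp only [add_sub_cancel] at h3
    exact h3
  have hq := H.tendsto_quasiQuantile hparam hprior hg hα
  have hσ := (H.tendsto_sqrt_quadForm_inv v).const_mul (normalQuantile α)
  have hall := (hq.sub hgθ).sub hσ
  have hzero : inner ℝ v (act J₀⁻¹ D₀) + normalQuantile α * √(quadForm J₀⁻¹ v)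
      - inner ℝ v (act J₀⁻¹ D₀) - normalQuantile α * √(quadForm J₀⁻¹ v) = 0 := by ring
  rw [hzero] at hall
  have hnorm := hall.norm
  rw [norm_zero] at hnorm
  refine absurd (ge_of_tendsto' hnorm fun k => ?_) (not_le.2 hη)
  refine le_trans (hsA k) (le_of_eq ?_)
  have hpos := H.t_pos k
  congr 1
  simp only [smul_eq_mul, one_div, inv_inv]
  field_simp
  ring

/-- The linearization of the quasi-posterior quantiles around `g θ₀`. -/
theorem tendsto_measure_quasiQuantile_linearization [IsProbabilityMeasure P]
    (hmeas : MeasurabilityAssumption Θ L Δ) (hparam : ParameterAssumption Θ θ₀)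
    (hprior : PriorAssumption Θ π) (hident : IdentifiabilityAssumption P Θ θ₀ L)
    (hexp : ExpansionAssumption P Θ θ₀ L Δ J Ω) {g : Vec d → ℝ} (hg : ContDiffOn ℝ 1 g Θ)
    {α : ℝ} (hα : α ∈ Set.Ioo (0 : ℝ) 1) {η : ℝ} (hη : 0 < η) :
    Tendsto (fun n : ℕ => P {s | η ≤ |√(n : ℝ) * (quasiQuantile Θ π L g n s α - g θ₀)
      - inner ℝ (gradient g θ₀) (act (J n)⁻¹ ((√(n : ℝ))⁻¹ • Δ n s))
      - normalQuantile α * √(quadForm (J n)⁻¹ (gradient g θ₀))|}) atTop (𝓝 0) := by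
  obtain ⟨c, hc⟩ := hexp.hessian.exists_isCoercive
  -- No estimator is involved here, so the auxiliary vanishing sequence is taken to be zero.
  have hX : IsLittleOP P (fun _ _ => (0 : Vec d)) (fun _ => 1) := by
    rw [isLittleOP_iff]
    intro ε hε
    simp [not_le.2 hε]
  refine tendsto_measure_zero_of_locallyQuadratic hmeas hident hexp hc hX ?_
  intro ns s δ ε m J₀ D₀ hsA _ H
  have hq := H.tendsto_quasiQuantile hparam hprior hg hα
  have hσ := (H.tendsto_sqrt_quadForm_inv (gradient g θ₀)).const_mul (normalQuantile α)
  have hV := (tendsto_const_nhds (x := gradient g θ₀)).inner (𝕜 := ℝ) H.tendsto_act_inv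
  have hall := ((hq.sub hV).sub hσ).abs
  simp only [add_sub_cancel_left, sub_self, abs_zero] at hall
  exact absurd (ge_of_tendsto' hall hsA) (not_le.2 hη)

/-! ### Asymptotic coverage -/

theorem normalQuantile_strictMonoOn : StrictMonoOn normalQuantile (Set.Ioo 0 1) := by
  intro a ha b hb hab
  by_contra! h
  have := monotone_cdf (gaussianReal 0 1) h
  rw [cdf_normalQuantile ha, cdf_normalQuantile hb] at this
  linarith

/-- In the limit coverage reads `V + q_a σ ≤ 0 ≤ V + q_b σ`, which confines `V` to this interval;
symmetry of the normal law reflects it to quantiles `a` and `b`. -/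
theorem gaussianReal_mul_mem_Icc {a b : ℝ} (ha : a ∈ Set.Ioo (0 : ℝ) 1)
    (hb : b ∈ Set.Ioo (0 : ℝ) 1) (hab : a < b) {σ : ℝ} (hσ : 0 < σ) :
    (gaussianReal 0 1).real
      {t | σ * t ∈ Set.Icc (-(normalQuantile b * σ)) (-(normalQuantile a * σ))} = b - a := by
  have h1 : {t | σ * t ∈ Set.Icc (-(normalQuantile b * σ)) (-(normalQuantile a * σ))}
      = (fun t => -t) ⁻¹' Set.Icc (normalQuantile a) (normalQuantile b) := by
    ext t
    simp only [Set.mem_ofPred_eq, Set.mem_Icc, Set.mem_preimage]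
    constructor
    · rintro ⟨h1, h2⟩
      constructor <;> nlinarith
    · rintro ⟨h1, h2⟩
      constructor <;> nlinarith
  have : NullSingletonClass (gaussianReal 0 1) := nullSingletonClass_gaussianReal one_ne_zero
  rw [h1, ← map_measureReal_apply (by fun_prop) measurableSet_Icc, gaussianReal_map_neg, neg_zero,
    measureReal_congr Ioc_ae_eq_Icc.symm, ← Set.Iic_sdiff_Iic,
    measureReal_sdiff (Set.Iic_subset_Iic.2 (normalQuantile_strictMonoOn ha hb hab).le)
      measurableSet_Iic, ← cdf_eq_real, ← cdf_eq_real, cdf_normalQuantile ha, cdf_normalQuantile hb]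

/-- Along a subsequence, the linearized score converges in distribution to a centred normal law
with the variance given by the information equality. -/
theorem ExpansionAssumption.exists_subseq_tendsto [IsProbabilityMeasure P]
    (hexp : ExpansionAssumption P Θ θ₀ L Δ J Ω)
    (hinfo : Tendsto (fun n => J n * (Ω n)⁻¹) atTop (𝓝 1)) {v : Vec d} (hv : v ≠ 0)
    {ns : ℕ → ℕ} (hns : Tendsto ns atTop atTop) :
    ∃ (ms : ℕ → ℕ) (σ : ℝ), Tendsto ms atTop atTop ∧ 0 < σ ∧
      Tendsto (fun k => √(quadForm (J (ns (ms k)))⁻¹ v)) atTop (𝓝 σ) ∧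
      ∀ a ∈ Set.Ioo (0 : ℝ) 1, ∀ b ∈ Set.Ioo (0 : ℝ) 1, a < b →
        Tendsto (fun k => P.real {s | inner ℝ v (act (J (ns (ms k)))⁻¹
            ((√(ns (ms k) : ℝ))⁻¹ • Δ (ns (ms k)) s))
          ∈ Set.Icc (-(normalQuantile b * σ)) (-(normalQuantile a * σ))}) atTop (𝓝 (b - a)) := by
  obtain ⟨c, hc⟩ := hexp.hessian.exists_isCoercive
  obtain ⟨c', hc'⟩ := hexp.variance.exists_isCoercive
  obtain ⟨J₀, φ, hφ, hJ₀⟩ := exists_subseq_tendsto_matrix hexp.hessian.bounded ns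
  obtain ⟨Ω₀, ψ, hψ, hΩ₀⟩ :=
    exists_subseq_tendsto_matrix hexp.variance.bounded (fun k => ns (φ k))
  replace hJ₀ := hJ₀.comp hψ.tendsto_atTop
  have hcJ : IsCoercive J₀ c := isCoercive_of_tendsto (fun k => hc _) hJ₀
  have hcΩ : IsCoercive Ω₀ c' := isCoercive_of_tendsto (fun k => hc' _) hΩ₀
  have hJinv := tendsto_matrix_inv hcJ.isUnit_det hJ₀
  -- The information equality passes to the limit as `J₀ Ω₀⁻¹ = 1`.
  have hΩJ : Ω₀ = J₀ := by
    have h1 := hinfo.comp (hns.comp (hφ.comp hψ).tendsto_atTop)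
    have h2 := tendsto_nhds_unique h1 (Filter.Tendsto.mul hJ₀
      (tendsto_matrix_inv hcΩ.isUnit_det hΩ₀))
    have h3 := congrArg (fun M => M * Ω₀) h2
    simpa [Matrix.mul_assoc, Matrix.nonsing_inv_mul _ hcΩ.isUnit_det] using h3
  -- This is `Ω^{1/2} J⁻¹ v`, the vector whose inner product with the whitened score is `v'J⁻¹D`.
  let u : ℕ → Vec d := fun n => act (invRoot (Ω n)) (act (Ω n) (act (J n)⁻¹ v))
  have hu : ∀ n, ‖u n‖ = √(quadForm (Ω n) (act (J n)⁻¹ v)) := fun n => by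
    rw [← Real.sqrt_sq (norm_nonneg (u n)), (hc' n).norm_act_invRoot_sq, quadForm,
      (hc' n).act_inv_act, quadForm, real_inner_comm]
  have hV : ∀ n D, inner ℝ v (act (J n)⁻¹ D) = inner ℝ (u n) (act (invRoot (Ω n)) D) := fun n D => by
    simp only [u]
    rw [← inner_act_of_isSymm (invRoot_isSymm _), (hc' n).act_invRoot_act_invRoot,
      ← inner_act_of_isSymm (hc' n).symm, (hc' n).act_act_inv,
      ← inner_act_of_isSymm (hc n).inv_isSymm]
  set σ := √(quadForm J₀⁻¹ v) with hσ
  have hσpos : 0 < σ := Real.sqrt_pos.2 (hcJ.quadForm_inv_pos hv)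
  have hσlim := (tendsto_quadForm hJinv (tendsto_const_nhds (x := v))).sqrt
  -- The squared norm is the sandwich variance `v'J⁻¹ΩJ⁻¹v`, which collapses to `v'J₀⁻¹v` because
  -- `Ω₀ = J₀`.
  have hulim : Tendsto (fun k => ‖u (ns (φ (ψ k)))‖) atTop (𝓝 σ) := by
    have h1 := (tendsto_quadForm hΩ₀ (tendsto_act hJinv (tendsto_const_nhds (x := v)))).sqrt
    have h2 : quadForm Ω₀ (act J₀⁻¹ v) = quadForm J₀⁻¹ v := by
      rw [hΩJ, quadForm, hcJ.act_act_inv, quadForm, real_inner_comm]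
    rw [h2] at h1
    exact h1.congr fun k => (hu _).symm
  obtain ⟨R, hR⟩ := (Metric.isBounded_range_of_tendsto _ hulim).exists_norm_le
  -- One more subsequence gives a limiting direction without continuity of the matrix root; the
  -- limit law depends only on `‖u₀‖ = σ`.
  obtain ⟨u₀, -, χ, hχ, hu₀⟩ := tendsto_subseq_of_bounded
    (Metric.isBounded_closedBall (x := (0 : Vec d)) (r := R)) (x := fun k => u (ns (φ (ψ k))))
    (fun k => mem_closedBall_zero_iff.2 (by simpa using hR _ ⟨k, rfl⟩))
  have hu₀σ : ‖u₀‖ = σ := tendsto_nhds_unique hu₀.norm (hulim.comp hχ.tendsto_atTop)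
  have hms : Tendsto (fun k => φ (ψ (χ k))) atTop atTop :=
    ((hφ.comp hψ).comp hχ).tendsto_atTop
  refine ⟨fun k => φ (ψ (χ k)), σ, hms, hσpos, hσlim.comp hχ.tendsto_atTop,
    fun a ha b hb hab => ?_⟩
  have hW : TendstoInDistribution (fun k s => act (invRoot (Ω (ns (φ (ψ (χ k))))))
      ((√(ns (φ (ψ (χ k))) : ℝ))⁻¹ • Δ (ns (φ (ψ (χ k)))) s)) atTop
      (id : Vec d → Vec d) (fun _ => P) (stdGaussian (Vec d)) :=
    { forall_aemeasurable := fun k => hexp.score_tendsto.forall_aemeasurable _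
      aemeasurable_limit := aemeasurable_id
      tendsto := hexp.score_tendsto.tendsto.comp (hns.comp hms) }
  have hY : TendstoInMeasure P (fun k (_ : S) => u (ns (φ (ψ (χ k))))) atTop (fun _ => u₀) := by
    rw [tendstoInMeasure_iff_norm]
    intro ε hε
    refine tendsto_const_nhds.congr' ?_
    filter_upwards [Metric.tendsto_nhds.1 hu₀ ε hε] with k hk
    have hk' : ‖u (ns (φ (ψ (χ k)))) - u₀‖ < ε := by rw [← dist_eq_norm]; exact hk
    simp [not_le.2 hk']
  -- Slutsky: a converging deterministic direction paired with a score converging in law.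
  have hdist := TendstoInDistribution.continuous_comp_prodMk_of_tendstoInMeasure_const
    (g := fun p : Vec d × Vec d => (inner ℝ p.2 p.1 : ℝ)) (by fun_prop) hW hY
    (fun _ => aemeasurable_const)
  have hIcc : -(normalQuantile b * σ) ≤ -(normalQuantile a * σ) := by
    have := normalQuantile_strictMonoOn ha hb hab
    nlinarith
  set I := Set.Icc (-(normalQuantile b * σ)) (-(normalQuantile a * σ)) with hI
  have hmap : (stdGaussian (Vec d)).map (fun z => (inner ℝ u₀ (id z) : ℝ))
      = (gaussianReal 0 1).map (fun t => σ * t) := by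
    rw [← hu₀σ]
    exact stdGaussian_map_inner u₀
  -- The limit law has no atoms because `σ > 0`, so the endpoints of the interval carry no mass.
  have hport := ProbabilityMeasure.tendsto_measure_of_null_frontier_of_tendsto' hdist.tendsto
    (E := I) (by
      simp only [ProbabilityMeasure.coe_mk]
      rw [hmap, hI, frontier_Icc hIcc, gaussianReal_map_const_mul]
      refine gaussianReal_absolutelyContinuous _ ?_ ((Set.toFinite _).measure_zero _)
      simp only [mul_one, ne_eq]
      intro h0
      have := congrArg NNReal.toReal h0
      simp at this
      exact hσpos.ne' this)
  simp only [ProbabilityMeasure.coe_mk] at hport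
  rw [hmap] at hport
  have hreal := (ENNReal.tendsto_toReal (measure_ne_top _ _)).comp hport
  rw [← gaussianReal_mul_mem_Icc ha hb hab hσpos]
  have hlim : ((gaussianReal 0 1).map (fun t => σ * t) I).toReal
      = (gaussianReal 0 1).real {t | σ * t ∈ I} := by
    rw [Measure.map_apply (by fun_prop) measurableSet_Icc]
    rfl
  rw [hlim] at hreal
  refine hreal.congr fun k => ?_
  simp only [Function.comp_apply]
  rw [Measure.map_apply_of_aemeasurable (hdist.forall_aemeasurable k) measurableSet_Icc,
    measureReal_def]
  simp_rw [hV]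
  rfl

/-- Outside the small linearization-error events, coverage is implied by `V` lying in a narrower
interval and implies that `V` lies in a wider one. Only monotonicity and subadditivity are applied
to the coverage event itself. -/
theorem tendsto_measure_quasiQuantile_Icc [IsProbabilityMeasure P]
    (hmeas : MeasurabilityAssumption Θ L Δ) (hparam : ParameterAssumption Θ θ₀)
    (hprior : PriorAssumption Θ π) (hident : IdentifiabilityAssumption P Θ θ₀ L)
    (hexp : ExpansionAssumption P Θ θ₀ L Δ J Ω)
    (hinfo : Tendsto (fun n => J n * (Ω n)⁻¹) atTop (𝓝 1))
    {g : Vec d → ℝ} (hg : ContDiffOn ℝ 1 g Θ) (hgrad : gradient g θ₀ ≠ 0)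
    {a b : ℝ} (ha : a ∈ Set.Ioo (0 : ℝ) 1) (hb : b ∈ Set.Ioo (0 : ℝ) 1) (hab : a < b) :
    Tendsto (fun n => P.real {s | quasiQuantile Θ π L g n s a ≤ g θ₀ ∧
      g θ₀ ≤ quasiQuantile Θ π L g n s b}) atTop (𝓝 (b - a)) := by
  refine tendsto_of_subseq_tendsto fun ns hns => ?_
  obtain ⟨ms, σ, hms, hσ, hσlim, hclt⟩ := hexp.exists_subseq_tendsto hinfo hgrad hns
  refine ⟨ms, ?_⟩
  set N : ℕ → ℕ := fun k => ns (ms k) with hN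
  have hNtop : Tendsto N atTop atTop := hns.comp hms
  set q := normalQuantile with hq
  set σn : ℕ → ℝ := fun k => √(quadForm (J (N k))⁻¹ (gradient g θ₀)) with hσn
  let V : ℕ → S → ℝ := fun k s =>
    inner ℝ (gradient g θ₀) (act (J (N k))⁻¹ ((√(N k : ℝ))⁻¹ • Δ (N k) s))
  let C : ℝ → ℕ → S → ℝ := fun β k s => √(N k : ℝ) * (quasiQuantile Θ π L g (N k) s β - g θ₀)
  let B : ℝ → ℝ → ℕ → Set S := fun η β k => {s | η ≤ |C β k s - V k s - q β * σn k|}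
  have hB : ∀ η β, 0 < η → β ∈ Set.Ioo (0 : ℝ) 1 →
      Tendsto (fun k => P.real (B η β k)) atTop (𝓝 0) := fun η β hη hβ => by
    have h1 := (tendsto_measure_quasiQuantile_linearization hmeas hparam hprior hident hexp hg hβ
      hη).comp hNtop
    have h2 := (ENNReal.tendsto_toReal ENNReal.zero_ne_top).comp h1
    rw [ENNReal.toReal_zero] at h2
    exact h2
  set A : ℕ → Set S := fun k => {s | quasiQuantile Θ π L g (N k) s a ≤ g θ₀ ∧
      g θ₀ ≤ quasiQuantile Θ π L g (N k) s b} with hA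
  have hmemA : ∀ᶠ k in atTop, ∀ s, s ∈ A k ↔ C a k s ≤ 0 ∧ 0 ≤ C b k s := by
    filter_upwards [hNtop.eventually_gt_atTop 0] with k hk s
    have hpos : 0 < √(N k : ℝ) := Real.sqrt_pos.2 (by exact_mod_cast hk)
    simp only [A, C, Set.mem_ofPred_eq, mul_nonneg_iff_of_pos_left hpos, sub_nonneg]
    refine and_congr_left fun _ => ⟨fun h => ?_, fun h => ?_⟩
    · exact mul_nonpos_of_nonneg_of_nonpos hpos.le (sub_nonpos.2 h)
    · by_contra! h'
      exact absurd h (not_le.2 (mul_pos hpos (sub_pos.2 h')))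
  have hgap : ∀ x y : ℝ, x ∈ Set.Ioo (0 : ℝ) 1 → y ∈ Set.Ioo (0 : ℝ) 1 → x < y →
      0 < (q y - q x) * σ := fun x y hx hy hxy =>
    mul_pos (sub_pos.2 (normalQuantile_strictMonoOn hx hy hxy)) hσ
  have hqσ : ∀ β, Tendsto (fun k => q β * σn k) atTop (𝓝 (q β * σ)) := fun β =>
    hσlim.const_mul (q β)
  rw [Metric.tendsto_nhds]
  intro ε hε
  -- Shifting the levels by `e` changes the limiting probability by `2 * e`. The bounds keep shifted
  -- levels in `(0, 1)`, the narrow interval nondegenerate and the change below `ε / 2`; the other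
  -- `ε / 2` pays for the linearization.
  obtain ⟨e, he0, hea, heb, heab, heε⟩ : ∃ e : ℝ, 0 < e ∧ e < a ∧ e < 1 - b ∧ 2 * e < b - a ∧
      2 * e < ε / 2 := by
    have h1 : 0 < min (min a (1 - b)) (min (b - a) (ε / 2)) := by
      refine lt_min (lt_min ha.1 ?_) (lt_min ?_ ?_) <;> linarith [hb.2]
    refine ⟨min (min a (1 - b)) (min (b - a) (ε / 2)) / 3, by positivity, ?_, ?_, ?_, ?_⟩
    · linarith [(min_le_left (min a (1 - b)) (min (b - a) (ε / 2))).trans (min_le_left _ _)]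
    · linarith [(min_le_left (min a (1 - b)) (min (b - a) (ε / 2))).trans (min_le_right _ _)]
    · linarith [(min_le_right (min a (1 - b)) (min (b - a) (ε / 2))).trans (min_le_left _ _)]
    · linarith [(min_le_right (min a (1 - b)) (min (b - a) (ε / 2))).trans (min_le_right _ _)]
  have ha₁ : a - e ∈ Set.Ioo (0 : ℝ) 1 := ⟨by linarith, by linarith [ha.2]⟩
  have ha₂ : a + e ∈ Set.Ioo (0 : ℝ) 1 := ⟨by linarith [ha.1], by linarith [hb.2]⟩
  have hb₁ : b - e ∈ Set.Ioo (0 : ℝ) 1 := ⟨by linarith [ha.1], by linarith [hb.2]⟩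
  have hb₂ : b + e ∈ Set.Ioo (0 : ℝ) 1 := ⟨by linarith [hb.1], by linarith⟩
  -- Strict monotonicity of the normal quantile leaves gaps between shifted and unshifted levels;
  -- `η` fits inside all four, with room for replacing `σ` by `σn k`.
  obtain ⟨η, hη, hη₁, hη₂, hη₃, hη₄⟩ : ∃ η : ℝ, 0 < η ∧ q (a - e) * σ < q a * σ - η ∧
      q a * σ + η < q (a + e) * σ ∧ q (b - e) * σ < q b * σ - η ∧
      q b * σ + η < q (b + e) * σ := by
    have h1 := hgap _ _ ha₁ ha (by linarith)
    have h2 := hgap _ _ ha ha₂ (by linarith)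
    have h3 := hgap _ _ hb₁ hb (by linarith)
    have h4 := hgap _ _ hb hb₂ (by linarith)
    obtain ⟨η, hη0, hη⟩ := exists_between (lt_min (lt_min h1 h2) (lt_min h3 h4))
    simp only [lt_min_iff] at hη
    exact ⟨η, hη0, by linarith [hη.1.1], by linarith [hη.1.2], by linarith [hη.2.1],
      by linarith [hη.2.2]⟩
  have hwide := hclt _ ha₁ _ hb₂ (by linarith)
  have hnarrow := hclt _ ha₂ _ hb₁ (by linarith)
  have hbad := (hB η a hη ha).add (hB η b hη hb)
  rw [add_zero] at hbad
  filter_upwards [hmemA, hwide.eventually_lt_const (show _ < b - a + ε / 2 by linarith),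
    hnarrow.eventually_const_lt (show b - a - ε / 2 < _ by linarith),
    hbad.eventually_lt_const (half_pos hε),
    ((hqσ a).sub_const η).eventually_const_lt hη₁, ((hqσ a).add_const η).eventually_lt_const hη₂,
    ((hqσ b).sub_const η).eventually_const_lt hη₃, ((hqσ b).add_const η).eventually_lt_const hη₄]
    with k hk hw hn hbk h1 h2 h3 h4
  have hunion : P.real (B η a k ∪ B η b k) < ε / 2 := (measureReal_union_le _ _).trans_lt hbk
  have hup : A k ⊆ {s | V k s ∈ Set.Icc (-(q (b + e) * σ)) (-(q (a - e) * σ))}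
      ∪ (B η a k ∪ B η b k) := fun s hs => by
    by_cases hsB : s ∈ B η a k ∪ B η b k
    · exact Or.inr hsB
    · left
      simp only [B, Set.mem_union, Set.mem_ofPred_eq, not_or, not_le, abs_lt] at hsB
      obtain ⟨h5, h6⟩ := (hk s).1 hs
      constructor <;> linarith [hsB.1.1, hsB.2.2]
  have hdown : {s | V k s ∈ Set.Icc (-(q (b - e) * σ)) (-(q (a + e) * σ))}
      ⊆ A k ∪ (B η a k ∪ B η b k) := fun s hs => by
    by_cases hsB : s ∈ B η a k ∪ B η b k
    · exact Or.inr hsB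
    · left
      simp only [B, Set.mem_union, Set.mem_ofPred_eq, not_or, not_le, abs_lt] at hsB
      obtain ⟨h5, h6⟩ := hs
      exact (hk s).2 ⟨by linarith [hsB.1.2], by linarith [hsB.2.1]⟩
  have hup' := (measureReal_mono hup (measure_ne_top P _)).trans (measureReal_union_le _ _)
  have hdown' := (measureReal_mono hdown (measure_ne_top P _)).trans (measureReal_union_le _ _)
  rw [Real.dist_eq, abs_lt]
  constructor <;> linarith

end LargeSample

end LTE

theorem theorem3 {d : ℕ} {S : Type*} [MeasurableSpace S] (P : Measure S) [IsProbabilityMeasure P]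
    (Θ : Set (LTE.Vec d)) (θ₀ : LTE.Vec d) (π : LTE.Vec d → ℝ)
    (L : ℕ → LTE.Vec d → S → ℝ) (Δ : ℕ → S → LTE.Vec d)
    (J Ω : ℕ → Matrix (Fin d) (Fin d) ℝ)
    (hmeas : LTE.MeasurabilityAssumption Θ L Δ)
    (hparam : LTE.ParameterAssumption Θ θ₀)
    (hprior : LTE.PriorAssumption Θ π)
    (hident : LTE.IdentifiabilityAssumption P Θ θ₀ L)
    (hexp : LTE.ExpansionAssumption P Θ θ₀ L Δ J Ω)
    (hinfo : Tendsto (fun n => J n * (Ω n)⁻¹) atTop (𝓝 1))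
    (g : LTE.Vec d → ℝ) (hg : ContDiffOn ℝ 1 g Θ)
    (α : ℝ) (hα : α ∈ Set.Ioo (0 : ℝ) 1) :
    (∀ θhat : ℕ → S → LTE.Vec d,
      LTE.IsLittleOP P
        (fun n s => √(n : ℝ) • (θhat n s - θ₀) - (√(n : ℝ))⁻¹ • LTE.act (J n)⁻¹ (Δ n s))
        (fun _ => 1) →
      LTE.IsLittleOP P
        (fun n s => LTE.quasiQuantile Θ π L g n s α - g (θhat n s)
          - LTE.normalQuantile α * (√(LTE.quadForm (J n)⁻¹ (gradient g θ₀)) / √(n : ℝ)))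
        (fun n => 1 / √(n : ℝ))) ∧
    (gradient g θ₀ ≠ 0 →
      Tendsto (fun n => P {s | LTE.quasiQuantile Θ π L g n s (α / 2) ≤ g θ₀ ∧
          g θ₀ ≤ LTE.quasiQuantile Θ π L g n s (1 - α / 2)})
        atTop (𝓝 (ENNReal.ofReal (1 - α)))) := by
  refine ⟨fun θhat hθhat => LTE.isLittleOP_quasiQuantile_sub hmeas hparam hprior hident hexp hg hα
    hθhat, fun hgrad => ?_⟩
  have h := LTE.tendsto_measure_quasiQuantile_Icc hmeas hparam hprior hident hexp hinfo hg hgrad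
    (a := α / 2) (b := 1 - α / 2) ⟨by linarith [hα.1], by linarith [hα.2]⟩
    ⟨by linarith [hα.2], by linarith [hα.1]⟩ (by linarith [hα.2])
  have heq : 1 - α / 2 - α / 2 = 1 - α := by ring
  rw [heq] at h
  refine (ENNReal.tendsto_ofReal h).congr fun n => ?_
  rw [measureReal_def, ENNReal.ofReal_toReal (measure_ne_top P _)]
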